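/- **Setting.** A metric measure space $(X,d,\mu)$ is a proper (hence complete) metric space with a Radon measure $\mu$; $B(x,r)$ is the open ball, and $f_B=\frac1{\mu(B)}\int_B f\,d\mu$ is the average of $f$ over $B$. It is *$D$-doubling* if $0<\mu(B(x,r))<\infty$ and $\mu(B(x,2r))\le D\,\mu(B(x,r))$ for all $x\in X$, $r>0$. A non-negative Borel function $g: X\to\mathbb R$ is an *upper gradient* of a Lipschitz function $f: X\to\mathbb R$ if $|f(\gamma(0))-f(\gamma(L))|\le\int_\gamma g\,ds$ for every rectifiable curve $\gamma:[0,L]\to X$, where $ds$ is arc length. Let $\Phi,\Psi:[0,\infty)\to[0,\infty)$ be non-decreasing with $\lim_{t\to0}\Phi(t)=\Phi(0)=0$ and $\lim_{t\to0}\Psi(t)=\Psi(0)=0$, and let $C\ge1$. The space satisfies a *non-homogeneous $(\Phi,\Psi,C)$-Poincaré inequality* if for every $2$-Lipschitz $f: X\to\mathbb R$, every upper gradient $g$ of $f$ and every ball $B(x,r)$ $$\frac1{\mu(B(x,r))}\int_{B(x,r)}|f-f_{B(x,r)}|\,d\mu\le r\,\Psi\Big(\frac1{\mu(B(x,Cr))}\int_{B(x,Cr)}\Phi\circ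 g\,d\mu\Big)$$ (nothing is required if the average on the right is infinite). The space is *$(C_1,\delta,\epsilon)$-connected* if for all $x\ne y$ in $X$, with $r=d(x,y)$, and every Borel set $E$ with $\mu(E\cap B(x,C_1r))<\epsilon\,\mu(B(x,C_1r))$ there are a compact set $K\subset\mathbb R$ with $\min K=0$ and a $1$-Lipschitz map $\gamma: K\to X$ with $\gamma(0)=x$, $\gamma(\max K)=y$, $\mathrm{len}(\gamma)\le C_1r$, $|[0,\max K]\setminus K|<\delta r$ and $\gamma^{-1}(E)\subset\{0,\max K\}$. Here $\mathrm{len}(\gamma)$ is the supremum of the sums $\sum_i d(\gamma(t_{i+1}),\gamma(t_i))$ over $t_1\le\dots\le t_n$ in $K$. For $1\le q<\infty$ the space satisfies a *$(1,q)$-Poincaré inequality with constants $(\lambda,C_2)$* if for every $n$, every Lipschitz $f: X\to\mathbb R^n$ and every ball $B(x,r)$ $$\frac1{\mu(B(x,r))}\int_{B(x,r)}|f-f_{B(x,r)}|\,d\mu\le C_2\,r\Big(\frac1{\mu(B(x,\lambda r))}\int_{B(x,\lambda r)}(\mathrm{lip}\, f)^q\,d\mu\Big)^{1/q},\qquad \mathrm{lip}\,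 f(x)=\liminf_{r\to0}\sup_{y\in B(x,r)}\frac{|f(x)-f(y)|}{r}.$$ **Theorem.** For all $D$, $\Phi$, $\Psi$ and $C$ as above there are constants $C_1>1$, $0<\delta<1$, $0<\epsilon<1$, $q>1$, $\lambda>0$ and $C_2>0$, depending only on $D,\Phi,\Psi,C$, such that every $D$-doubling metric measure space that satisfies a non-homogeneous $(\Phi,\Psi,C)$-Poincaré inequality is $(C_1,\delta,\epsilon)$-connected and satisfies a $(1,q)$-Poincaré inequality with constants $(\lambda,C_2)$. (Quasiconvexity is not assumed.) -/

import Mathlib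

open MeasureTheory Filter Topology Set
open scoped ENNReal NNReal

/-- `μ` is a `D`-doubling measure: every ball has positive finite measure, and doubling the radius
of a ball multiplies its measure at most by `D`, at every scale. -/
structure IsDoublingMM {X : Type*} [MetricSpace X] [MeasurableSpace X]
    (μ : Measure X) (D : ℝ≥0) : Prop where
  measure_ball_pos : ∀ (x : X) (r : ℝ), 0 < r → 0 < μ (Metric.ball x r)
  measure_ball_lt_top : ∀ (x : X) (r : ℝ), 0 < r → μ (Metric.ball x r) < ∞
  doubling : ∀ (x : X) (r : ℝ), 0 < r →
    μ (Metric.ball x (2 * r)) ≤ (D : ℝ≥0∞) * μ (Metric.ball x r)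

/-- The length of the curve `γ : [0, L] → X`: the supremum of the sums `∑ d(γ(tᵢ₊₁), γ(tᵢ))`. -/
noncomputable def curveLength {X : Type*} [MetricSpace X] (γ : ℝ → X) (L : ℝ) : ℝ≥0∞ :=
  eVariationOn γ (Icc 0 L)

/-- The integral of `g` with respect to arc length along a rectifiable curve `γ : [0, L] → X`,
i.e. the integral of `g` along the arc-length parametrization of `γ`, which is defined on
`[0, len γ]`. It may be infinite. -/
noncomputable def curveIntegralArc {X : Type*} [MetricSpace X] (g : X → ℝ≥0) (γ : ℝ → X) (L : ℝ) :
    ℝ≥0∞ :=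
  ∫⁻ s in Icc 0 (curveLength γ L).toReal, (g (naturalParameterization γ (Icc 0 L) 0 s) : ℝ≥0∞)

/-- `g` is an upper gradient of `f`: it is a non-negative Borel function, and for every rectifiable
curve `γ : [0, L] → X` (continuous and of finite length) `|f(γ(0)) - f(γ(L))| ≤ ∫_γ g ds`. -/
structure IsUpperGradientOf {X : Type*} [MetricSpace X] [MeasurableSpace X]
    (g : X → ℝ≥0) (f : X → ℝ) : Prop where
  measurable : Measurable g
  le_integral : ∀ (L : ℝ), 0 ≤ L → ∀ γ : ℝ → X, ContinuousOn γ (Icc 0 L) → curveLength γ L ≠ ∞ →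
    edist (f (γ 0)) (f (γ L)) ≤ curveIntegralArc g γ L

/-- An increasing function `Φ : [0, ∞) → [0, ∞)` with `lim_{t → 0} Φ(t) = Φ(0) = 0`. -/
structure IsGauge (Φ : ℝ≥0 → ℝ≥0) : Prop where
  monotone : Monotone Φ
  map_zero : Φ 0 = 0
  tendsto_zero : Tendsto Φ (𝓝 0) (𝓝 0)

/-- The non-homogeneous `(Φ, Ψ, C)`-Poincaré inequality: for every `2`-Lipschitz function `f`,
every upper gradient `g` of `f`, and every ball `B(x, r)`,
`⨍_{B(x,r)} |f - f_{B(x,r)}| dμ ≤ r Ψ(⨍_{B(x,Cr)} Φ ∘ g dμ)`.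
Nothing is required when the average on the right is infinite. -/
def NonhomogeneousPoincare {X : Type*} [MetricSpace X] [MeasurableSpace X]
    (μ : Measure X) (Φ Ψ : ℝ≥0 → ℝ≥0) (C : ℝ) : Prop :=
  ∀ f : X → ℝ, LipschitzWith 2 f → ∀ g : X → ℝ≥0, IsUpperGradientOf g f →
    ∀ (x : X) (r : ℝ), 0 < r →
      ⨍⁻ y in Metric.ball x (C * r), (Φ (g y) : ℝ≥0∞) ∂μ ≠ ∞ →
      ⨍⁻ y in Metric.ball x r, edist (f y) (⨍ z in Metric.ball x r, f z ∂μ) ∂μ ≤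
        ENNReal.ofReal r *
          (Ψ (⨍⁻ y in Metric.ball x (C * r), (Φ (g y) : ℝ≥0∞) ∂μ).toNNReal : ℝ≥0∞)

/-- The pair `(x, y)` is `(C, δ, ε)`-connected: for every Borel set `E` (the obstacle) with
`μ(E ∩ B(x, Cr)) < ε μ(B(x, Cr))`, `r = d(x, y)`, there is a `1`-Lipschitz curve fragment
`γ : K → X`, `K ⊆ ℝ` compact with `min K = 0` and `max K = T`, from `x = γ(0)` to `y = γ(T)`, with
`len(γ) ≤ C r` and `|[0, T] \ K| < δ r`, which meets `E` at most at its two end points. -/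
def IsConnectedPair {X : Type*} [MetricSpace X] [MeasurableSpace X]
    (μ : Measure X) (C δ ε : ℝ) (x y : X) : Prop :=
  ∀ E : Set X, MeasurableSet E →
    μ (E ∩ Metric.ball x (C * dist x y)) <
      ENNReal.ofReal ε * μ (Metric.ball x (C * dist x y)) →
    ∃ (K : Set ℝ) (T : ℝ) (γ : ℝ → X),
      IsCompact K ∧ IsLeast K 0 ∧ IsGreatest K T ∧
      LipschitzOnWith 1 γ K ∧ γ 0 = x ∧ γ T = y ∧
      eVariationOn γ K ≤ ENNReal.ofReal (C * dist x y) ∧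
      volume (Icc 0 T \ K) < ENNReal.ofReal (δ * dist x y) ∧
      ∀ t ∈ K, γ t ∈ E → t = 0 ∨ t = T

/-- The space is `(C, δ, ε)`-connected (at all scales). -/
def IsConnectedMM {X : Type*} [MetricSpace X] [MeasurableSpace X]
    (μ : Measure X) (C δ ε : ℝ) : Prop :=
  ∀ x y : X, 0 < dist x y → IsConnectedPair μ C δ ε x y

/-- The lower pointwise Lipschitz constant
`lip f (x) = liminf_{r → 0} sup_{y ∈ B(x, r)} |f(x) - f(y)| / r`. -/
noncomputable def lowerLip {X Y : Type*} [MetricSpace X] [MetricSpace Y] (f : X → Y) (x : X) :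
    ℝ≥0∞ :=
  liminf (fun r : ℝ => (⨆ y ∈ Metric.ball x r, edist (f x) (f y)) / ENNReal.ofReal r) (𝓝[>] 0)

/-- The `(1, p)`-Poincaré inequality with constants `(C, C')`: for every Lipschitz map
`f : X → ℝⁿ` (any `n`, Euclidean norm) and every ball `B(x, r)`,
`⨍_{B(x,r)} |f - f_{B(x,r)}| dμ ≤ C' r (⨍_{B(x,Cr)} (lip f)^p dμ)^{1/p}`. -/
def PoincareInequality {X : Type*} [MetricSpace X] [MeasurableSpace X]
    (μ : Measure X) (p C C' : ℝ) : Prop :=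
  ∀ (n : ℕ) (f : X → EuclideanSpace ℝ (Fin n)), (∃ K : ℝ≥0, LipschitzWith K f) →
    ∀ (x : X) (r : ℝ), 0 < r →
      ⨍⁻ y in Metric.ball x r, edist (f y) (⨍ z in Metric.ball x r, f z ∂μ) ∂μ ≤
        ENNReal.ofReal (C' * r) *
          (⨍⁻ y in Metric.ball x (C * r), lowerLip f y ^ p ∂μ) ^ (1 / p)

/-!
The proof has two independent halves, linked by the notion of a curve fragment and by a weak type
estimate for the uncentred maximal function (`measure_ball_inter_maximalSuperlevel_le`), which says
that a function with small averages on large balls has small averages on all balls around most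
points.

*Connectivity.* The obstacle is enlarged to an open set `U` of small measure, and `x`, `y` are
replaced by nearby points `p`, `q` at which `U` has low density at every scale. The travel cost `f`
from `p` charges the gaps of a fragment avoiding `U` at rate `1` and its duration at a small rate
`τ` (`travelCost`). This function is `2`-Lipschitz, vanishes at `p` and has the upper gradient
`1_U + τ` (`isUpperGradientOf_travelCost`). As `Φ` and `Ψ` tend to `0` at `0`, the non-homogeneous
Poincaré inequality makes the mean oscillation of `f` over `B(p, t)` and `B(q, t)` a small multiple
of `t`, for all `t`. A telescoping argument gives `f q ≤ d(x, y) / 8`, so there is a fragment from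
`p` to `q` with small gaps and bounded duration. Two jumps extend it to `x` and `y`
(`exists_isFragmentConnected`).

*Poincaré inequality.* Let `g` be the lower Lipschitz constant of `f`, and suppose that the maximal
function of `g ^ q` is at most `s ^ q` at `a` and `b`. If `q` is large, the points where `g ^ q` or
its maximal function exceeds `(2 s) ^ q` have small density around `a`, so a fragment from `a` to
`b` avoids them, with gaps of total length at most `d(a, b) / 4`. Along the fragment `f` changes by
`O(s d(a, b))`, by a one-dimensional covering argument (`volume_image_le_mul_of_frequently`,
`sub_le_of_volume_image_le`). Each gap is a pair of points of the same kind with `2 s` in place of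
`s`, and the argument is repeated there. As `2 / 4 < 1`, the resulting series converges and
`|f a - f b| ≤ 8 C s d(a, b)` (`IsFragmentConnected.abs_sub_le`). Finally the weak type estimate is
integrated over a ball, using that the `q`-th root of the maximal function is integrable as `q > 1`
(`IsFragmentConnected.oscillation_le`).
-/


/-! ### Doubling measures and the weak type inequality -/

theorem IsDoublingMM.mono {X : Type*} [MetricSpace X] [MeasurableSpace X] {μ : Measure X}
    {D D' : ℝ≥0} (h : IsDoublingMM μ D) (hD : D ≤ D') : IsDoublingMM μ D' :=
  ⟨h.measure_ball_pos, h.measure_ball_lt_top, fun x r hr =>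
    (h.doubling x r hr).trans (by gcongr)⟩

theorem IsDoublingMM.measure_ball_le {X : Type*} [MetricSpace X] [MeasurableSpace X]
    {μ : Measure X} {D : ℝ≥0} (h : IsDoublingMM μ D) {x y : X} {r r' : ℝ} (n : ℕ) (hr : 0 < r)
    (hsub : r' + dist x y ≤ 2 ^ n * r) :
    μ (Metric.ball x r') ≤ (D : ℝ≥0∞) ^ n * μ (Metric.ball y r) := by
  have key : ∀ n : ℕ, μ (Metric.ball y (2 ^ n * r)) ≤ (D : ℝ≥0∞) ^ n * μ (Metric.ball y r) := by
    intro n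
    induction n with
    | zero => simp
    | succ n ih =>
      calc μ (Metric.ball y (2 ^ (n + 1) * r)) = μ (Metric.ball y (2 * (2 ^ n * r))) := by ring_nf
        _ ≤ D * μ (Metric.ball y (2 ^ n * r)) := h.doubling _ _ (by positivity)
        _ ≤ D * ((D : ℝ≥0∞) ^ n * μ (Metric.ball y r)) := by gcongr
        _ = _ := by ring
  exact (measure_mono (Metric.ball_subset_ball' hsub)).trans (key n)

/-- The superlevel set at height `σ` of the uncentred Hardy–Littlewood maximal function of `G`:
the union of all balls over which the average of `G` exceeds `σ`. -/
def maximalSuperlevel {X : Type*} [MetricSpace X] [MeasurableSpace X] (μ : Measure X)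
    (G : X → ℝ≥0∞) (σ : ℝ≥0∞) : Set X :=
  {z | ∃ (w : X) (t : ℝ), 0 < t ∧ z ∈ Metric.ball w t ∧
    σ * μ (Metric.ball w t) < ∫⁻ y in Metric.ball w t, G y ∂μ}

section maximal

variable {X : Type*} [MetricSpace X] [MeasurableSpace X] {μ : Measure X} {G : X → ℝ≥0∞}

theorem isOpen_maximalSuperlevel (σ : ℝ≥0∞) : IsOpen (maximalSuperlevel μ G σ) := by
  have : maximalSuperlevel μ G σ = ⋃ (w : X) (t : ℝ) (_ : 0 < t ∧
      σ * μ (Metric.ball w t) < ∫⁻ y in Metric.ball w t, G y ∂μ), Metric.ball w t := by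
    ext z
    simp only [maximalSuperlevel, mem_ofPred_eq, mem_iUnion, exists_prop]
    exact exists_congr fun w => exists_congr fun t => by tauto
  rw [this]
  exact isOpen_iUnion fun w => isOpen_iUnion fun t => isOpen_iUnion fun _ => Metric.isOpen_ball

theorem maximalSuperlevel_anti {σ σ' : ℝ≥0∞} (h : σ ≤ σ') :
    maximalSuperlevel μ G σ' ⊆ maximalSuperlevel μ G σ := by
  rintro z ⟨w, t, ht, hz, hlt⟩
  exact ⟨w, t, ht, hz, lt_of_le_of_lt (by gcongr) hlt⟩

theorem lintegral_ball_le_of_notMem_maximalSuperlevel {σ : ℝ≥0∞} {z w : X} {t : ℝ}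
    (h : z ∉ maximalSuperlevel μ G σ) (hz : z ∈ Metric.ball w t) :
    ∫⁻ y in Metric.ball w t, G y ∂μ ≤ σ * μ (Metric.ball w t) := by
  by_contra hlt
  exact h ⟨w, t, dist_nonneg.trans_lt hz, hz, not_le.1 hlt⟩

/-- Weak type `(1, 1)` estimate localized to a ball `B(a, ρ)`: if the averages of `G` over the
larger concentric balls are at most `s`, then balls of radius at least `ρ` contribute only to low
superlevels, and the smaller ones are handled by the Vitali covering lemma. -/
theorem measure_ball_inter_maximalSuperlevel_le [BorelSpace X] [SecondCountableTopology X]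
    {D : ℝ≥0} (h : IsDoublingMM μ D) (hD : 1 ≤ D) (a : X) {ρ : ℝ} (hρ : 0 < ρ) {s : ℝ≥0∞}
    (σ : ℝ≥0∞)
    (hs : ∀ t, ρ ≤ t → ∫⁻ y in Metric.ball a t, G y ∂μ ≤ s * μ (Metric.ball a t)) :
    σ * μ (Metric.ball a ρ ∩ maximalSuperlevel μ G σ) ≤
      (D : ℝ≥0∞) ^ 5 * s * μ (Metric.ball a ρ) := by
  have hD' : (1 : ℝ≥0∞) ≤ D := by exact_mod_cast hD
  rcases lt_or_ge σ ((D : ℝ≥0∞) ^ 3 * s) with hσ | hσ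
  · calc σ * μ (Metric.ball a ρ ∩ maximalSuperlevel μ G σ)
        ≤ ((D : ℝ≥0∞) ^ 3 * s) * μ (Metric.ball a ρ) :=
          mul_le_mul' hσ.le (measure_mono inter_subset_left)
      _ ≤ _ := by gcongr; norm_num
  let I : Set (X × ℝ) := {p | 0 < p.2 ∧ p.2 < ρ ∧ (Metric.ball a ρ ∩ Metric.ball p.1 p.2).Nonempty ∧
    σ * μ (Metric.ball p.1 p.2) < ∫⁻ y in Metric.ball p.1 p.2, G y ∂μ}
  obtain ⟨u, huI, hdisj, hcov⟩ := Vitali.exists_disjoint_subfamily_covering_enlargement_closedBall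
    I (fun p => p.1) (fun p => p.2) ρ (fun p hp => hp.2.1.le) 5 (by norm_num)
  have hdisj' : u.PairwiseDisjoint fun p => Metric.ball p.1 p.2 := fun p hp q hq hpq =>
    (hdisj hp hq hpq).mono Metric.ball_subset_closedBall Metric.ball_subset_closedBall
  have hcount : u.Countable := hdisj'.countable_of_isOpen (fun _ _ => Metric.isOpen_ball)
    fun p hp => ⟨p.1, Metric.mem_ball_self (huI hp).1⟩
  have hsub : Metric.ball a ρ ∩ maximalSuperlevel μ G σ ⊆
      ⋃ p ∈ u, Metric.ball p.1 (8 * p.2) := by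
    rintro z ⟨hza, w, t, ht, hzw, hlt⟩
    have htρ : t < ρ := by
      by_contra htρ
      push Not at htρ
      have haw : dist a w < ρ + t := by
        have := dist_triangle_left a w z
        rw [Metric.mem_ball] at hza hzw
        linarith
      apply hlt.not_ge
      calc ∫⁻ y in Metric.ball w t, G y ∂μ ≤ ∫⁻ y in Metric.ball a (4 * t), G y ∂μ :=
            lintegral_mono_set (Metric.ball_subset_ball' (by rw [dist_comm]; linarith))
        _ ≤ s * μ (Metric.ball a (4 * t)) := hs _ (by linarith)
        _ ≤ s * ((D : ℝ≥0∞) ^ 3 * μ (Metric.ball w t)) := by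
            gcongr
            exact h.measure_ball_le 3 ht (by linarith)
        _ = ((D : ℝ≥0∞) ^ 3 * s) * μ (Metric.ball w t) := by ring
        _ ≤ σ * μ (Metric.ball w t) := by gcongr
    obtain ⟨p, hp, hsubp⟩ := hcov (w, t) ⟨ht, htρ, ⟨z, hza, hzw⟩, hlt⟩
    refine mem_biUnion hp ?_
    refine Metric.closedBall_subset_ball ?_ (hsubp (Metric.ball_subset_closedBall hzw))
    have := (huI hp).1
    linarith
  calc σ * μ (Metric.ball a ρ ∩ maximalSuperlevel μ G σ)
      ≤ σ * ∑' p : u, μ (Metric.ball p.1.1 (8 * p.1.2)) := by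
        gcongr
        exact (measure_mono hsub).trans (measure_biUnion_le μ hcount _)
    _ ≤ σ * ∑' p : u, (D : ℝ≥0∞) ^ 3 * μ (Metric.ball p.1.1 p.1.2) := by
        gcongr with p
        exact h.measure_ball_le 3 (huI p.2).1 (by simp; linarith)
    _ = (D : ℝ≥0∞) ^ 3 * ∑' p : u, σ * μ (Metric.ball p.1.1 p.1.2) := by
        rw [ENNReal.tsum_mul_left, ENNReal.tsum_mul_left]; ring
    _ ≤ (D : ℝ≥0∞) ^ 3 * ∑' p : u, ∫⁻ y in Metric.ball p.1.1 p.1.2, G y ∂μ := by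
        gcongr with p
        exact (huI p.2).2.2.2.le
    _ = (D : ℝ≥0∞) ^ 3 * ∫⁻ y in ⋃ p ∈ u, Metric.ball p.1 p.2, G y ∂μ := by
        rw [lintegral_biUnion hcount (fun _ _ => Metric.isOpen_ball.measurableSet) hdisj']
    _ ≤ (D : ℝ≥0∞) ^ 3 * ∫⁻ y in Metric.ball a (3 * ρ), G y ∂μ := by
        gcongr
        refine iUnion₂_subset fun p hp => ?_
        refine Metric.ball_subset_ball' ?_
        obtain ⟨-, hpρ, ⟨z, hza, hzp⟩, -⟩ := huI hp
        have := dist_triangle_left p.1 a z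
        rw [Metric.mem_ball] at hza hzp
        linarith
    _ ≤ (D : ℝ≥0∞) ^ 3 * (s * ((D : ℝ≥0∞) ^ 2 * μ (Metric.ball a ρ))) := by
        gcongr
        exact (hs _ (by linarith)).trans (by
          gcongr
          exact h.measure_ball_le 2 hρ (by simp; linarith))
    _ = _ := by ring

end maximal

/-! ### Curve fragments -/

/-- `γ : K → X` is a curve fragment: a `1`-Lipschitz map on a compact set `K ⊆ ℝ` with `min K = 0`
and `max K = T`. Values of `γ` off `K` carry no meaning. -/
structure IsFragment {X : Type*} [MetricSpace X] (K : Set ℝ) (T : ℝ) (γ : ℝ → X) : Prop where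
  isCompact : IsCompact K
  isLeast : IsLeast K 0
  isGreatest : IsGreatest K T
  lipschitz : LipschitzOnWith 1 γ K

section fragment

variable {X : Type*} [MetricSpace X]

theorem IsFragment.nonneg {K : Set ℝ} {T : ℝ} {γ : ℝ → X} (h : IsFragment K T γ) : 0 ≤ T :=
  h.isLeast.2 h.isGreatest.1

theorem IsFragment.dist_le {K : Set ℝ} {T : ℝ} {γ : ℝ → X} (h : IsFragment K T γ) {t u : ℝ}
    (ht : t ∈ K) (hu : u ∈ K) : dist (γ t) (γ u) ≤ |t - u| := by
  simpa [Real.dist_eq] using h.lipschitz.dist_le_mul t ht u hu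

theorem isFragment_singleton (x : X) : IsFragment {0} 0 fun _ => x :=
  ⟨isCompact_singleton, isLeast_singleton, isGreatest_singleton, LipschitzOnWith.of_dist_le_mul
    fun t _ u _ => by simp⟩

theorem IsFragment.eVariationOn_le {K : Set ℝ} {T : ℝ} {γ : ℝ → X} (h : IsFragment K T γ) :
    eVariationOn γ K ≤ ENNReal.ofReal T := by
  calc eVariationOn γ K ≤ (1 : ℝ≥0) * eVariationOn (id : ℝ → ℝ) K :=
        h.lipschitz.comp_eVariationOn_le (mapsTo_id K)
    _ ≤ ENNReal.ofReal T := by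
        have h1 := (monotone_id.monotoneOn K).eVariationOn_eq h.isLeast.1 h.isGreatest.1
        have h2 : K ∩ Icc 0 T = K :=
          inter_eq_left.2 fun t ht => ⟨h.isLeast.2 ht, h.isGreatest.2 ht⟩
        rw [h2] at h1
        simpa using h1.le

/-- Two fragments can be joined by a jump of length `s` (which is allowed to be `0`). The jump adds
`s` to the measure of the gaps. -/
theorem IsFragment.concat {K₁ K₂ : Set ℝ} {T₁ T₂ s : ℝ} {γ₁ γ₂ : ℝ → X}
    (h₁ : IsFragment K₁ T₁ γ₁) (h₂ : IsFragment K₂ T₂ γ₂) (hs : dist (γ₁ T₁) (γ₂ 0) ≤ s) :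
    ∃ (K : Set ℝ) (γ : ℝ → X), IsFragment K (T₁ + s + T₂) γ ∧ γ 0 = γ₁ 0 ∧
      γ (T₁ + s + T₂) = γ₂ T₂ ∧
      volume (Icc 0 (T₁ + s + T₂) \ K) ≤
        volume (Icc 0 T₁ \ K₁) + ENNReal.ofReal s + volume (Icc 0 T₂ \ K₂) ∧
      ∀ t ∈ K, (t ∈ K₁ ∧ γ t = γ₁ t) ∨ ∃ k ∈ K₂, t = T₁ + s + k ∧ γ t = γ₂ k := by
  have hs0 : 0 ≤ s := dist_nonneg.trans hs
  have hT₁ := h₁.nonneg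
  have hT₂ := h₂.nonneg
  set γ : ℝ → X := fun t => if t ≤ T₁ then γ₁ t else γ₂ (t - T₁ - s) with hγ
  have e₁ : ∀ t ∈ K₁, γ t = γ₁ t := fun t ht => if_pos (h₁.isGreatest.2 ht)
  have e₂ : ∀ k ∈ K₂, γ (T₁ + s + k) = γ₂ k := by
    intro k hk
    have hk0 : 0 ≤ k := h₂.isLeast.2 hk
    simp only [hγ]
    split_ifs with hle
    · -- the two pieces overlap only if there is no jump, and then they agree at the common point
      have hk' : k = 0 := by linarith
      have hs' : s = 0 := by linarith
      subst hk' hs'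
      simpa using dist_le_zero.1 hs
    · congr 1; ring
  refine ⟨K₁ ∪ (fun k => T₁ + s + k) '' K₂, γ, ⟨?_, ⟨Or.inl h₁.isLeast.1, ?_⟩,
    ⟨Or.inr ⟨T₂, h₂.isGreatest.1, rfl⟩, ?_⟩, ?_⟩, e₁ 0 h₁.isLeast.1, e₂ T₂ h₂.isGreatest.1, ?_, ?_⟩
  · exact h₁.isCompact.union (h₂.isCompact.image (by fun_prop))
  · rintro t (ht | ⟨k, hk, rfl⟩)
    · exact h₁.isLeast.2 ht
    · have := h₂.isLeast.2 hk
      positivity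
  · rintro t (ht | ⟨k, hk, rfl⟩)
    · linarith [h₁.isGreatest.2 ht]
    · simpa using h₂.isGreatest.2 hk
  · have cross : ∀ t ∈ K₁, ∀ k ∈ K₂, dist (γ t) (γ (T₁ + s + k)) ≤ |t - (T₁ + s + k)| := by
      intro t ht k hk
      have hk0 : 0 ≤ k := h₂.isLeast.2 hk
      have htT : t ≤ T₁ := h₁.isGreatest.2 ht
      rw [e₁ t ht, e₂ k hk, abs_of_nonpos (by linarith)]
      have d₁ := h₁.dist_le ht h₁.isGreatest.1
      have d₂ := h₂.dist_le h₂.isLeast.1 hk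
      rw [abs_of_nonpos (by linarith)] at d₁ d₂
      linarith [dist_triangle4 (γ₁ t) (γ₁ T₁) (γ₂ 0) (γ₂ k)]
    refine LipschitzOnWith.of_dist_le_mul ?_
    rintro t (ht | ⟨k, hk, rfl⟩) u (hu | ⟨l, hl, rfl⟩) <;> rw [NNReal.coe_one, one_mul, Real.dist_eq]
    · rw [e₁ t ht, e₁ u hu]
      exact h₁.dist_le ht hu
    · exact cross t ht l hl
    · rw [dist_comm, abs_sub_comm]
      exact cross u hu k hk
    · simp only [e₂ k hk, e₂ l hl]
      convert h₂.dist_le hk hl using 2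
      ring
  · have hsub : Icc 0 (T₁ + s + T₂) \ (K₁ ∪ (fun k => T₁ + s + k) '' K₂) ⊆
        (Icc 0 T₁ \ K₁ ∪ Icc T₁ (T₁ + s)) ∪ (fun k => (T₁ + s) + k) '' (Icc 0 T₂ \ K₂) := by
      rintro t ⟨⟨h0, hT⟩, ht⟩
      simp only [mem_union, not_or] at ht
      rcases le_or_gt t T₁ with h | h
      · exact Or.inl (Or.inl ⟨⟨h0, h⟩, ht.1⟩)
      rcases le_or_gt t (T₁ + s) with h' | h'
      · exact Or.inl (Or.inr ⟨h.le, h'⟩)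
      · refine Or.inr ⟨t - (T₁ + s), ⟨⟨by linarith, by linarith⟩, fun hk => ht.2 ⟨_, hk, ?_⟩⟩, ?_⟩ <;>
          ring
    refine (measure_mono hsub).trans ((measure_union_le _ _).trans ?_)
    rw [image_add_left, measure_preimage_add]
    gcongr
    refine (measure_union_le _ _).trans ?_
    simp
  · rintro t (ht | ⟨k, hk, rfl⟩)
    · exact Or.inl ⟨ht, e₁ t ht⟩
    · exact Or.inr ⟨k, hk, rfl, e₂ k hk⟩

/-- The arc-length parametrization of a continuous rectifiable curve is `1`-Lipschitz on all of
`[0, len γ]`. Continuity of `γ` makes the length function continuous, hence onto `[0, len γ]`. -/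
theorem naturalParameterization_lipschitzOnWith {γ : ℝ → X} {L : ℝ} (hL : 0 ≤ L)
    (hγ : ContinuousOn γ (Icc 0 L)) (hlen : curveLength γ L ≠ ∞) :
    LipschitzOnWith 1 (naturalParameterization γ (Icc 0 L) 0) (Icc 0 (curveLength γ L).toReal) ∧
      naturalParameterization γ (Icc 0 L) 0 0 = γ 0 ∧
      naturalParameterization γ (Icc 0 L) 0 (curveLength γ L).toReal = γ L := by
  have h0 : (0 : ℝ) ∈ Icc 0 L := ⟨le_rfl, hL⟩
  have h1 : L ∈ Icc 0 L := ⟨hL, le_rfl⟩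
  have hbv : LocallyBoundedVariationOn γ (Icc 0 L) :=
    BoundedVariationOn.locallyBoundedVariationOn hlen
  set v := variationOnFromTo γ (Icc 0 L) 0 with hv
  have v0 : v 0 = 0 := variationOnFromTo.self _ _ _
  have vL : v L = (curveLength γ L).toReal := by
    rw [hv, variationOnFromTo.eq_of_le _ _ hL, inter_self, curveLength]
  have hcont : ContinuousOn v (Icc 0 L) := by
    intro b hb
    have hl : ContinuousWithinAt v (Icc 0 L ∩ Iio b) b := by
      have := variationOnFromTo.tendsto_left h0 hb hbv ((hγ b hb).mono inter_subset_left)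
      rwa [dist_self, sub_zero] at this
    have hr : ContinuousWithinAt v (Icc 0 L ∩ Ioi b) b := by
      have := variationOnFromTo.tendsto_right h0 hb hbv ((hγ b hb).mono inter_subset_left)
      rwa [dist_self, add_zero] at this
    refine ((hl.union hr).union (continuousWithinAt_singleton (x := b))).mono fun t ht => ?_
    rcases lt_trichotomy t b with h | h | h
    · exact Or.inl (Or.inl ⟨ht, h⟩)
    · exact Or.inr h
    · exact Or.inl (Or.inr ⟨ht, h⟩)
  have hsurj : Icc 0 (curveLength γ L).toReal ⊆ v '' Icc 0 L := by
    have := intermediate_value_Icc hL hcont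
    rwa [v0, vL] at this
  have key : ∀ b ∈ Icc 0 L, naturalParameterization γ (Icc 0 L) 0 (v b) = γ b := fun b hb =>
    edist_eq_zero.1 (edist_naturalParameterization_eq_zero hbv h0 hb)
  have hus := has_unit_speed_naturalParameterization γ hbv h0
  have k0 := key 0 h0
  have kL := key L h1
  rw [v0] at k0
  rw [vL] at kL
  refine ⟨?_, k0, kL⟩
  have hle : ∀ s ∈ v '' Icc 0 L, ∀ t ∈ v '' Icc 0 L, s ≤ t →
      edist (naturalParameterization γ (Icc 0 L) 0 s) (naturalParameterization γ (Icc 0 L) 0 t) ≤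
        edist s t := by
    intro s hs t ht hst
    have h2 := eVariationOn.edist_le (naturalParameterization γ (Icc 0 L) 0)
      (show s ∈ v '' Icc 0 L ∩ Icc s t from ⟨hs, le_rfl, hst⟩)
      (show t ∈ v '' Icc 0 L ∩ Icc s t from ⟨ht, hst, le_rfl⟩)
    rw [hus hs ht] at h2
    refine h2.trans_eq ?_
    rw [edist_comm, edist_dist, Real.dist_eq, abs_of_nonneg (by linarith)]
    simp
  intro s hs t ht
  rw [ENNReal.coe_one, one_mul]
  rcases le_total s t with h | h
  · exact hle s (hsurj hs) t (hsurj ht) h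
  · rw [edist_comm, edist_comm s]
    exact hle t (hsurj ht) s (hsurj hs) h

end fragment

/-! ### The cost of travelling around an obstacle -/

section cost

variable {X : Type*} [MetricSpace X]

/-- The possible costs of travelling from `x` to `z` while paying for the obstacle `U`: follow a
fragment from `x` which avoids `U`, paying for its gaps at rate `1` and for its duration at rate
`τ`, and finally jump to `z` at rate `1 + τ`. -/
def travelCosts (U : Set X) (τ : ℝ≥0) (x z : X) : Set ℝ :=
  {c | ∃ (K : Set ℝ) (T : ℝ) (γ : ℝ → X) (gap : ℝ), IsFragment K T γ ∧ γ 0 = x ∧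
    (∀ t ∈ K, γ t ∉ U) ∧ 0 ≤ gap ∧ volume (Icc 0 T \ K) ≤ ENNReal.ofReal gap ∧
    c = gap + τ * T + (1 + τ) * dist (γ T) z}

/-- The infimal cost of travelling from `x` to `z` with obstacle `U`; see `travelCosts`. -/
noncomputable def travelCost (U : Set X) (τ : ℝ≥0) (x z : X) : ℝ := sInf (travelCosts U τ x z)

variable {U : Set X} {τ : ℝ≥0} {x : X}

theorem nonneg_of_mem_travelCosts {z : X} {c : ℝ} (hc : c ∈ travelCosts U τ x z) : 0 ≤ c := by
  obtain ⟨K, T, γ, gap, hK, -, -, hgap, -, rfl⟩ := hc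
  have := hK.nonneg
  positivity

theorem bddBelow_travelCosts (z : X) : BddBelow (travelCosts U τ x z) :=
  ⟨0, fun _ => nonneg_of_mem_travelCosts⟩

theorem jump_mem_travelCosts (hx : x ∉ U) (z : X) :
    (1 + τ) * dist x z ∈ travelCosts U τ x z :=
  ⟨{0}, 0, fun _ => x, 0, isFragment_singleton x, rfl, fun _ _ => hx, le_rfl, by simp, by simp⟩

theorem travelCosts_nonempty (hx : x ∉ U) (z : X) : (travelCosts U τ x z).Nonempty :=
  ⟨_, jump_mem_travelCosts hx z⟩

theorem travelCost_nonneg (z : X) : 0 ≤ travelCost U τ x z :=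
  Real.sInf_nonneg fun _ => nonneg_of_mem_travelCosts

theorem travelCost_self (hx : x ∉ U) : travelCost U τ x x = 0 :=
  le_antisymm ((csInf_le (bddBelow_travelCosts x) (jump_mem_travelCosts hx x)).trans_eq (by simp))
    (travelCost_nonneg x)

theorem travelCost_le_add (hx : x ∉ U) (z w : X) :
    travelCost U τ x z ≤ travelCost U τ x w + (1 + τ) * dist w z := by
  rw [← sub_le_iff_le_add]
  refine le_csInf (travelCosts_nonempty hx w) ?_
  rintro _ ⟨K, T, γ, gap, hK, h0, hU, hgap, hvol, rfl⟩
  rw [sub_le_iff_le_add]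
  refine (csInf_le (bddBelow_travelCosts z) ⟨K, T, γ, gap, hK, h0, hU, hgap, hvol, rfl⟩).trans ?_
  have := mul_le_mul_of_nonneg_left (dist_triangle (γ T) w z) (by positivity : (0 : ℝ) ≤ 1 + τ)
  linarith

theorem lipschitzWith_travelCost (hx : x ∉ U) (hτ : τ ≤ 1) :
    LipschitzWith 2 (travelCost U τ x) := by
  have h2 : LipschitzWith (1 + τ) (travelCost U τ x) :=
    LipschitzWith.of_le_add_mul _ fun z w => by
      rw [dist_comm]
      exact_mod_cast travelCost_le_add hx z w
  exact h2.weaken (by rw [← one_add_one_eq_two]; gcongr)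

/-- A point outside the obstacle is reached, at a cost close to optimal, by a fragment that avoids
the obstacle altogether. -/
theorem exists_fragment_of_travelCost_lt (hx : x ∉ U) {z : X} (hz : z ∉ U) {c : ℝ}
    (hc : travelCost U τ x z < c) :
    ∃ (K : Set ℝ) (T : ℝ) (γ : ℝ → X) (gap : ℝ), IsFragment K T γ ∧ γ 0 = x ∧ γ T = z ∧
      (∀ t ∈ K, γ t ∉ U) ∧ 0 ≤ gap ∧ volume (Icc 0 T \ K) ≤ ENNReal.ofReal gap ∧
      gap + τ * T < c := by
  obtain ⟨_, ⟨K, T, γ, gap, hK, h0, hU, hgap, hvol, rfl⟩, hlt⟩ :=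
    exists_lt_of_csInf_lt (travelCosts_nonempty hx z) hc
  obtain ⟨K', γ', hK', h0', hT', hvol', hmem⟩ :=
    hK.concat (isFragment_singleton z) (le_refl (dist (γ T) z))
  refine ⟨K', _, γ', gap + dist (γ T) z, hK', h0'.trans h0, hT', ?_, by positivity, ?_, ?_⟩
  · intro t ht
    rcases hmem t ht with ⟨h, e⟩ | ⟨k, -, -, e⟩
    · rw [e]; exact hU t h
    · rwa [e]
  · rw [ENNReal.ofReal_add hgap dist_nonneg]
    refine hvol'.trans ?_
    simpa using hvol
  · linarith

/-- Along a `1`-Lipschitz curve the travel cost increases at most by the time spent in the obstacle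
plus `τ` times the duration. -/
theorem travelCost_curve_le (hU : IsOpen U) (hx : x ∉ U) {c : ℝ → X} {l : ℝ} (hl : 0 ≤ l)
    (hc : LipschitzOnWith 1 c (Icc 0 l)) :
    travelCost U τ x (c l) ≤
      travelCost U τ x (c 0) + volume.real (Icc 0 l ∩ c ⁻¹' U) + τ * l := by
  have hd : ∀ t ∈ Icc 0 l, ∀ u ∈ Icc 0 l, t ≤ u → dist (c t) (c u) ≤ u - t := by
    intro t ht u hu htu
    have := hc.dist_le_mul t ht u hu
    rwa [NNReal.coe_one, one_mul, dist_comm t, Real.dist_eq, abs_of_nonneg (by linarith)] at this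
  set A : Set ℝ := Icc 0 l ∩ c ⁻¹' Uᶜ with hA
  have hAsub : A ⊆ Icc 0 l := inter_subset_left
  have hAclosed : IsClosed A :=
    hc.continuousOn.preimage_isClosed_of_isClosed isClosed_Icc hU.isClosed_compl
  have hAcomp : IsCompact A := isCompact_Icc.of_isClosed_subset hAclosed hAsub
  have hV : Icc 0 l ∩ c ⁻¹' U = Icc 0 l \ A := by
    ext t
    simp only [hA, mem_inter_iff, mem_preimage, mem_compl_iff, Set.mem_sdiff]
    tauto
  have hVreal : volume.real (Icc 0 l ∩ c ⁻¹' U) = l - volume.real A := by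
    rw [hV, measureReal_sdiff hAsub hAclosed.measurableSet (by simp)]
    simp [hl]
  rw [hVreal]
  have h0 : (0 : ℝ) ∈ Icc 0 l := ⟨le_rfl, hl⟩
  have h1 : l ∈ Icc 0 l := ⟨hl, le_rfl⟩
  rcases A.eq_empty_or_nonempty with hem | hne
  · have := travelCost_le_add (τ := τ) hx (c l) (c 0)
    have h2 := mul_le_mul_of_nonneg_left (hd 0 h0 l h1 hl) (by positivity : (0 : ℝ) ≤ 1 + τ)
    rw [hem]
    simp only [measureReal_empty]
    linarith
  obtain ⟨a, ha⟩ := hAcomp.exists_isLeast hne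
  obtain ⟨b, hb⟩ := hAcomp.exists_isGreatest hne
  have hab : a ≤ b := ha.2 hb.1
  have haI := hAsub ha.1
  have hbI := hAsub hb.1
  have hAab : A ⊆ Icc a b := fun t ht => ⟨ha.2 ht, hb.2 ht⟩
  -- the part of the curve between the first and the last exit from the obstacle
  have hfrag : IsFragment ((fun t => -a + t) '' A) (-a + b) fun t => c (t + a) := by
    refine ⟨hAcomp.image (by fun_prop), ⟨⟨a, ha.1, by simp⟩, ?_⟩, ⟨⟨b, hb.1, rfl⟩, ?_⟩, ?_⟩
    · rintro _ ⟨t, ht, rfl⟩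
      simpa using ha.2 ht
    · rintro _ ⟨t, ht, rfl⟩
      simpa using hb.2 ht
    · refine LipschitzOnWith.of_dist_le_mul ?_
      rintro _ ⟨t, ht, rfl⟩ _ ⟨u, hu, rfl⟩
      simpa using hc.dist_le_mul t (hAsub ht) u (hAsub hu)
  have hgapvol : volume (Icc 0 (-a + b) \ (fun t => -a + t) '' A) =
      ENNReal.ofReal (b - a - volume.real A) := by
    have : Icc 0 (-a + b) \ (fun t => -a + t) '' A = (fun t => -a + t) '' (Icc a b \ A) := by
      rw [image_sdiff (add_right_injective _), image_const_add_Icc, neg_add_cancel]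
    rw [this, image_add_left, measure_preimage_add,
      ← ofReal_measureReal ((measure_mono sdiff_subset).trans_lt measure_Icc_lt_top).ne,
      measureReal_sdiff hAab hAclosed.measurableSet (by simp)]
    simp [hab]
  have hgap0 : 0 ≤ b - a - volume.real A := by
    have := measureReal_mono (μ := volume) hAab (by simp)
    simp only [Real.volume_real_Icc_of_le hab] at this
    linarith
  have key : travelCost U τ x (c l) ≤ travelCost U τ x (c 0) + (l - volume.real A + τ * l) := by
    rw [← sub_le_iff_le_add]
    refine le_csInf (travelCosts_nonempty hx _) ?_
    rintro _ ⟨K, T, γ, gap, hK, hγ0, hKU, hgap, hvol, rfl⟩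
    rw [sub_le_iff_le_add]
    have hjump : dist (γ T) (c (0 + a)) ≤ dist (γ T) (c 0) + a := by
      have := hd 0 h0 a haI haI.1
      rw [zero_add]
      linarith [dist_triangle (γ T) (c 0) (c a)]
    obtain ⟨K', γ', hK', h0', hT', hvol', hmem⟩ := hK.concat hfrag hjump
    have hmemcost : (gap + (dist (γ T) (c 0) + a) + (b - a - volume.real A)) +
        τ * (T + (dist (γ T) (c 0) + a) + (-a + b)) + (1 + τ) * dist (c b) (c l) ∈
        travelCosts U τ x (c l) := by
      refine ⟨K', _, γ', gap + (dist (γ T) (c 0) + a) + (b - a - volume.real A), hK',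
        h0'.trans hγ0, ?_, by have := haI.1; positivity, ?_, ?_⟩
      · intro t ht
        rcases hmem t ht with ⟨h, e⟩ | ⟨_, ⟨k, hk, rfl⟩, -, e⟩
        · rw [e]; exact hKU t h
        · rw [e]
          simpa using hk.2
      · rw [ENNReal.ofReal_add (by have := haI.1; positivity) hgap0,
          ENNReal.ofReal_add hgap (by have := haI.1; positivity), ← hgapvol]
        exact hvol'.trans (by gcongr)
      · rw [hT']
        simp
    refine (csInf_le (bddBelow_travelCosts _) hmemcost).trans ?_
    have h2 := mul_le_mul_of_nonneg_left (hd b hbI l h1 hbI.2) (by positivity : (0 : ℝ) ≤ 1 + τ)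
    linarith
  linarith

/-- The function `1_U + τ`. -/
noncomputable def obstacleGradient (U : Set X) (τ : ℝ≥0) (z : X) : ℝ≥0 :=
  U.indicator (fun _ => 1) z + τ

theorem isUpperGradientOf_travelCost [MeasurableSpace X] [BorelSpace X] (hU : IsOpen U)
    (hx : x ∉ U) : IsUpperGradientOf (obstacleGradient U τ) (travelCost U τ x) := by
  refine ⟨(measurable_const.indicator hU.measurableSet).add_const τ, ?_⟩
  intro L hL γ hγ hlen
  obtain ⟨hlip, h0, h1⟩ := naturalParameterization_lipschitzOnWith hL hγ hlen
  set c := naturalParameterization γ (Icc 0 L) 0 with hc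
  set l := (curveLength γ L).toReal with hl
  have hl0 : 0 ≤ l := ENNReal.toReal_nonneg
  set V : Set ℝ := Icc 0 l ∩ c ⁻¹' U with hV
  have hVm : MeasurableSet V := by
    have : V = Icc 0 l \ (Icc 0 l ∩ c ⁻¹' Uᶜ) := by
      ext t
      simp only [hV, mem_inter_iff, mem_preimage, mem_compl_iff, Set.mem_sdiff]
      tauto
    rw [this]
    exact measurableSet_Icc.diff (hlip.continuousOn.preimage_isClosed_of_isClosed isClosed_Icc
      hU.isClosed_compl).measurableSet
  have hint : curveIntegralArc (obstacleGradient U τ) γ L =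
      ENNReal.ofReal (volume.real V + τ * l) := by
    have e : curveIntegralArc (obstacleGradient U τ) γ L =
        ∫⁻ s in Icc 0 l, (V.indicator (fun _ => (1 : ℝ≥0∞)) s + τ) := by
      refine setLIntegral_congr_fun measurableSet_Icc fun s hs => ?_
      by_cases hsU : c s ∈ U
      · have hsV : s ∈ V := ⟨hs, hsU⟩
        simp [obstacleGradient, hsU, hsV, ← hc]
      · have hsV : s ∉ V := fun h => hsU h.2
        simp [obstacleGradient, hsU, hsV, ← hc]
    rw [e, lintegral_add_right _ measurable_const, lintegral_indicator hVm,
      ENNReal.ofReal_add measureReal_nonneg (by positivity)]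
    congr 1
    · rw [setLIntegral_one, Measure.restrict_apply hVm, inter_eq_left.2 inter_subset_left,
        ofReal_measureReal ((measure_mono inter_subset_left).trans_lt
          (by simp : volume (Icc 0 l) < ∞)).ne]
    · simp [ENNReal.ofReal_mul]
  rw [hint, edist_dist, Real.dist_eq, ← h0, ← h1]
  refine ENNReal.ofReal_le_ofReal (abs_sub_le_iff.2 ⟨?_, ?_⟩)
  · have hlip' : LipschitzOnWith 1 (fun t => c (l - t)) (Icc 0 l) := by
      refine LipschitzOnWith.of_dist_le_mul fun t ht u hu => ?_
      have := hlip.dist_le_mul (l - t) ⟨by linarith [ht.2], by linarith [ht.1]⟩ (l - u)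
        ⟨by linarith [hu.2], by linarith [hu.1]⟩
      rwa [dist_sub_left] at this
    have h2 := travelCost_curve_le (τ := τ) hU hx hl0 hlip'
    have h3 : Icc 0 l ∩ (fun t => c (l - t)) ⁻¹' U = (fun t => l - t) ⁻¹' V := by
      ext t
      simp only [hV, mem_inter_iff, mem_preimage, mem_Icc]
      constructor <;> rintro ⟨⟨_, _⟩, h⟩ <;> exact ⟨⟨by linarith, by linarith⟩, h⟩
    have h4 : volume.real ((fun t => l - t) ⁻¹' V) = volume.real V := by
      simp only [measureReal_def]
      rw [(Measure.measurePreserving_sub_left volume l).measure_preimage hVm.nullMeasurableSet]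
    rw [h3, h4] at h2
    simp only [sub_self, sub_zero] at h2
    linarith
  · have h2 := travelCost_curve_le (τ := τ) hU hx hl0 hlip
    linarith

end cost

/-! ### Averages over balls -/

section averages

variable {X : Type*} [MeasurableSpace X] {μ : Measure X}

theorem edist_setAverage_le {F : Type*} [NormedAddCommGroup F] [NormedSpace ℝ F] [CompleteSpace F]
    {f : X → F} {s : Set X} (h0 : μ s ≠ 0) (h1 : μ s ≠ ∞) (hf : IntegrableOn f s μ) (c : F) :
    edist (⨍ y in s, f y ∂μ) c ≤ ⨍⁻ y in s, edist (f y) c ∂μ := by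
  have : NeZero (μ.restrict s) := ⟨fun h => h0 (by rwa [Measure.restrict_eq_zero] at h)⟩
  have : IsFiniteMeasure (μ.restrict s) := ⟨by simpa using h1.lt_top⟩
  have hi : Integrable f ((μ.restrict s univ)⁻¹ • μ.restrict s) :=
    hf.smul_measure (by simpa using h0)
  have e : (⨍ y in s, f y ∂μ) - c = ∫ y, (f y - c) ∂((μ.restrict s univ)⁻¹ • μ.restrict s) := by
    rw [integral_sub hi (integrable_const c), average, integral_const]
    simp [measureReal_def, ENNReal.toReal_ne_zero, h0, h1]
  rw [edist_eq_enorm_sub, e]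
  refine (enorm_integral_le_lintegral_enorm _).trans_eq ?_
  simp only [laverage, edist_eq_enorm_sub]

theorem setLAverage_le_mul_of_subset {f : X → ℝ≥0∞} {s t : Set X} {M : ℝ≥0∞} (hst : s ⊆ t)
    (ht : μ t ≠ ∞) (hM : μ t ≤ M * μ s) :
    ⨍⁻ y in s, f y ∂μ ≤ M * ⨍⁻ y in t, f y ∂μ := by
  rw [setLAverage_eq _ f s]
  refine ENNReal.div_le_of_le_mul ?_
  calc ∫⁻ y in s, f y ∂μ ≤ ∫⁻ y in t, f y ∂μ := lintegral_mono_set hst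
    _ = μ t * ⨍⁻ y in t, f y ∂μ := (measure_mul_setLAverage f ht).symm
    _ ≤ M * μ s * ⨍⁻ y in t, f y ∂μ := by gcongr
    _ = _ := by ring

theorem setLAverage_le_of_lintegral_le {f : X → ℝ≥0∞} {s : Set X} {M : ℝ≥0∞}
    (hM : ∫⁻ y in s, f y ∂μ ≤ M * μ s) : ⨍⁻ y in s, f y ∂μ ≤ M := by
  rw [setLAverage_eq]
  exact ENNReal.div_le_of_le_mul hM

end averages

section doubling

variable {X : Type*} [MetricSpace X] [MeasurableSpace X] {μ : Measure X} {D : ℝ≥0}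

theorem IsDoublingMM.isLocallyFiniteMeasure (h : IsDoublingMM μ D) : IsLocallyFiniteMeasure μ :=
  ⟨fun x => ⟨Metric.ball x 1, Metric.ball_mem_nhds x one_pos,
    h.measure_ball_lt_top x 1 one_pos⟩⟩

variable [BorelSpace X]

theorem IsDoublingMM.notMem_of_notMem_maximalSuperlevel_indicator (h : IsDoublingMM μ D)
    {U : Set X} (hU : IsOpen U) {θ : ℝ≥0∞} (hθ : θ < 1) {z : X}
    (hz : z ∉ maximalSuperlevel μ (U.indicator 1) θ) : z ∉ U := by
  intro hzU
  obtain ⟨r, hr, hsub⟩ := Metric.isOpen_iff.1 hU z hzU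
  refine hz ⟨z, r, hr, Metric.mem_ball_self hr, ?_⟩
  rw [lintegral_indicator_one hU.measurableSet, Measure.restrict_apply hU.measurableSet,
    inter_eq_right.2 hsub]
  simpa using ENNReal.mul_lt_mul_left (h.measure_ball_pos z r hr).ne'
    (h.measure_ball_lt_top z r hr).ne hθ

variable [ProperSpace X]

theorem IsDoublingMM.integrableOn_ball (h : IsDoublingMM μ D) {F : Type*} [NormedAddCommGroup F]
    {f : X → F} (hf : Continuous f) (x : X) (r : ℝ) : IntegrableOn f (Metric.ball x r) μ := by
  have := h.isLocallyFiniteMeasure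
  exact (hf.continuousOn.integrableOn_compact (isCompact_closedBall x r)).mono_set
    Metric.ball_subset_closedBall

/-- Comparison of a ball average with a constant to which `f` is close on average over a larger
ball. -/
theorem IsDoublingMM.dist_setAverage_ball_le (h : IsDoublingMM μ D) {f : X → ℝ}
    (hf : Continuous f) {x y : X} {r R e : ℝ} (n : ℕ) (hr : 0 < r) (hR : 0 < R) (he : 0 ≤ e)
    (hsub : r + dist x y ≤ R) (hsup : R + dist x y ≤ 2 ^ n * r) (c : ℝ)
    (hc : ⨍⁻ z in Metric.ball y R, edist (f z) c ∂μ ≤ ENNReal.ofReal e) :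
    dist (⨍ z in Metric.ball x r, f z ∂μ) c ≤ (D : ℝ) ^ n * e := by
  have h1 := edist_setAverage_le (h.measure_ball_pos x r hr).ne' (h.measure_ball_lt_top x r hr).ne
    (h.integrableOn_ball hf x r) c
  have h2 := setLAverage_le_mul_of_subset (f := fun z => edist (f z) c)
    (Metric.ball_subset_ball' hsub) (h.measure_ball_lt_top y R hR).ne
    (h.measure_ball_le (x := y) (r' := R) n hr (by rwa [dist_comm]))
  have h3 := (h1.trans h2).trans (mul_le_mul_right hc _)
  rw [edist_dist] at h3
  rw [← ENNReal.ofReal_le_ofReal_iff (by positivity)]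
  refine h3.trans_eq ?_
  rw [ENNReal.ofReal_mul (by positivity), ENNReal.ofReal_pow (by positivity),
    ENNReal.ofReal_coe_nnreal]

/-- Telescoping over the balls `B(p, 2⁻ⁱ t)`: if the mean oscillation of `f` is at most `κ` times the
radius on all balls centred at `p`, then `f p` is close to the average of `f` over each of them. -/
theorem IsDoublingMM.dist_setAverage_ball_self_le (h : IsDoublingMM μ D) {f : X → ℝ}
    (hf : LipschitzWith 2 f) {p : X} {κ : ℝ} (hκ : 0 ≤ κ)
    (hosc : ∀ t, 0 < t → ⨍⁻ y in Metric.ball p t, edist (f y) (⨍ z in Metric.ball p t, f z ∂μ) ∂μ ≤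
      ENNReal.ofReal (κ * t)) {t : ℝ} (ht : 0 < t) :
    dist (⨍ z in Metric.ball p t, f z ∂μ) (f p) ≤ 2 * D * κ * t := by
  have key : ∀ n : ℕ, ∀ t : ℝ, 0 < t →
      dist (⨍ z in Metric.ball p t, f z ∂μ) (f p) ≤ 2 * D * κ * t + 2 * t * (1 / 2) ^ n := by
    intro n
    induction n with
    | zero =>
      intro t ht
      have h1 := h.dist_setAverage_ball_le hf.continuous (x := p) (y := p) (r := t) (R := t)
        (e := 2 * t) 0 ht ht (by positivity) (by simp) (by simp) (f p) (by
          refine setLAverage_le_of_lintegral_le ?_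
          rw [← setLIntegral_const]
          refine setLIntegral_mono' measurableSet_ball fun z hz => ?_
          rw [edist_dist]
          refine ENNReal.ofReal_le_ofReal ((hf.dist_le_mul z p).trans ?_)
          have := (Metric.mem_ball.1 hz).le
          simpa using this)
      have h2 : 0 ≤ 2 * D * κ * t := by positivity
      simp only [pow_zero, one_mul, mul_one] at h1 ⊢
      linarith
    | succ n ih =>
      intro t ht
      have h1 := ih (t / 2) (by positivity)
      have h2 := h.dist_setAverage_ball_le hf.continuous (x := p) (y := p) (r := t / 2) (R := t)
        (e := κ * t) 1 (by positivity) ht (by positivity) (by simp; linarith)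
        (by rw [dist_self]; linarith) _ (hosc t ht)
      have h3 := dist_triangle_left (⨍ z in Metric.ball p t, f z ∂μ) (f p)
        (⨍ z in Metric.ball p (t / 2), f z ∂μ)
      rw [pow_one] at h2
      rw [pow_succ]
      linarith
  have hlim : Tendsto (fun n : ℕ => 2 * D * κ * t + 2 * t * (1 / 2 : ℝ) ^ n) atTop
      (𝓝 (2 * D * κ * t + 2 * t * 0)) :=
    ((tendsto_pow_atTop_nhds_zero_of_lt_one (by norm_num) (by norm_num)).const_mul _).const_add _
  rw [mul_zero, add_zero] at hlim
  exact ge_of_tendsto' hlim fun n => key n t ht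

/-- A Lipschitz function with mean oscillation at most `κ` times the radius on all balls centred at
`p` or at `q` differs little between `p` and `q`. -/
theorem IsDoublingMM.dist_le_of_oscillation (h : IsDoublingMM μ D) (hD : 1 ≤ D) {f : X → ℝ}
    (hf : LipschitzWith 2 f) {p q : X} {κ : ℝ} (hκ : 0 ≤ κ)
    (hp : ∀ t, 0 < t → ⨍⁻ y in Metric.ball p t, edist (f y) (⨍ z in Metric.ball p t, f z ∂μ) ∂μ ≤
      ENNReal.ofReal (κ * t))
    (hq : ∀ t, 0 < t → ⨍⁻ y in Metric.ball q t, edist (f y) (⨍ z in Metric.ball q t, f z ∂μ) ∂μ ≤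
      ENNReal.ofReal (κ * t)) {t : ℝ} (ht : 0 < t) (hpq : dist p q ≤ t) :
    dist (f p) (f q) ≤ 8 * D ^ 2 * κ * t := by
  have h1 := h.dist_setAverage_ball_self_le hf hκ hp (t := 2 * t) (by positivity)
  have h2 := h.dist_setAverage_ball_self_le hf hκ hq ht
  have h3 := h.dist_setAverage_ball_le hf.continuous (x := q) (y := p) (r := t) (R := 2 * t)
    (e := κ * (2 * t)) 2 ht (by positivity) (by positivity) (by rw [dist_comm]; linarith)
    (by rw [dist_comm]; linarith) _ (hp (2 * t) (by positivity))
  have h4 := dist_triangle4 (f p) (⨍ z in Metric.ball p (2 * t), f z ∂μ)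
    (⨍ z in Metric.ball q t, f z ∂μ) (f q)
  have hD' : (1 : ℝ) ≤ D := hD
  have h5 : (D : ℝ) * (κ * t) ≤ (D : ℝ) ^ 2 * (κ * t) := by
    gcongr
    nlinarith
  rw [dist_comm] at h1 h3
  linarith

/-- If the total integral of `G` is small compared with the measure of a ball, then the ball contains
a point at which the maximal function of `G` is small. -/
theorem IsDoublingMM.exists_mem_ball_notMem_maximalSuperlevel (h : IsDoublingMM μ D) (hD : 1 ≤ D)
    {G : X → ℝ≥0∞} (a : X) {ρ : ℝ} (hρ : 0 < ρ) {s θ : ℝ≥0∞} (hsθ : (D : ℝ≥0∞) ^ 5 * s < θ)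
    (hG : ∫⁻ y, G y ∂μ ≤ s * μ (Metric.ball a ρ)) :
    ∃ z ∈ Metric.ball a ρ, z ∉ maximalSuperlevel μ G θ := by
  by_contra! hcon
  have h1 := measure_ball_inter_maximalSuperlevel_le (G := G) h hD a hρ (s := s) θ fun t ht =>
    (setLIntegral_le_lintegral _ _).trans (hG.trans (by gcongr))
  rw [inter_eq_left.2 hcon] at h1
  exact h1.not_gt (ENNReal.mul_lt_mul_left (h.measure_ball_pos a ρ hρ).ne'
    (h.measure_ball_lt_top a ρ hρ).ne hsθ)

end doubling

/-! ### Connectivity from the non-homogeneous Poincaré inequality -/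

/-- Quantitative connectivity with gaps of total measure less than `d(x, y) / 4` and with control of
the duration `T` of the fragment; compare `IsConnectedPair`, which only controls its length. -/
def IsFragmentConnected {X : Type*} [MetricSpace X] [MeasurableSpace X] (μ : Measure X)
    (C ε : ℝ) : Prop :=
  ∀ x y : X, 0 < dist x y → ∀ E : Set X, MeasurableSet E →
    μ (E ∩ Metric.ball x (C * dist x y)) <
      ENNReal.ofReal ε * μ (Metric.ball x (C * dist x y)) →
    ∃ (K : Set ℝ) (T : ℝ) (γ : ℝ → X), IsFragment K T γ ∧ γ 0 = x ∧ γ T = y ∧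
      T < C * dist x y ∧ volume (Icc 0 T \ K) < ENNReal.ofReal (1 / 4 * dist x y) ∧
      ∀ t ∈ K, γ t ∈ E → t = 0 ∨ t = T

theorem IsFragmentConnected.isConnectedMM {X : Type*} [MetricSpace X] [MeasurableSpace X]
    {μ : Measure X} {C ε : ℝ} (h : IsFragmentConnected μ C ε) : IsConnectedMM μ C (1 / 4) ε := by
  intro x y hxy E hE hsmall
  obtain ⟨K, T, γ, hK, h0, hT, hlen, hgap, havoid⟩ := h x y hxy E hE hsmall
  exact ⟨K, T, γ, hK.isCompact, hK.isLeast, hK.isGreatest, hK.lipschitz, h0, hT,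
    hK.eVariationOn_le.trans (ENNReal.ofReal_le_ofReal hlen.le), hgap, havoid⟩

/-- Around a point of low density of the obstacle the travel cost has small mean oscillation, at
all scales. -/
theorem NonhomogeneousPoincare.oscillation_travelCost_le {X : Type*} [MetricSpace X]
    [MeasurableSpace X] [BorelSpace X] {μ : Measure X} {Φ Ψ : ℝ≥0 → ℝ≥0} {C : ℝ}
    (hP : NonhomogeneousPoincare μ Φ Ψ C) (hΦ : IsGauge Φ) (hΨ : IsGauge Ψ) (hC : 1 ≤ C) {U : Set X}
    (hU : IsOpen U) {τ θ v κ : ℝ≥0} (hτ : τ ≤ 1) (hv : Φ 2 * θ + Φ τ ≤ v) (hκ : Ψ v ≤ κ) {x p : X}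
    (hx : x ∉ U) (hp : p ∉ maximalSuperlevel μ (U.indicator 1) θ) {t : ℝ} (ht : 0 < t) :
    ⨍⁻ y in Metric.ball p t, edist (travelCost U τ x y)
      (⨍ z in Metric.ball p t, travelCost U τ x z ∂μ) ∂μ ≤ ENNReal.ofReal (κ * t) := by
  have hle : ⨍⁻ y in Metric.ball p (C * t), (Φ (obstacleGradient U τ y) : ℝ≥0∞) ∂μ ≤ v := by
    refine setLAverage_le_of_lintegral_le ?_
    have hpt : ∀ y, (Φ (obstacleGradient U τ y) : ℝ≥0∞) ≤ Φ 2 * U.indicator 1 y + Φ τ := by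
      intro y
      by_cases hy : y ∈ U
      · simp only [obstacleGradient, hy, indicator_of_mem, Pi.one_apply, mul_one]
        have : Φ (1 + τ) ≤ Φ 2 := hΦ.monotone (by rw [← one_add_one_eq_two]; gcongr)
        exact_mod_cast this.trans le_self_add
      · simp [obstacleGradient, hy]
    calc ∫⁻ y in Metric.ball p (C * t), (Φ (obstacleGradient U τ y) : ℝ≥0∞) ∂μ
        ≤ ∫⁻ y in Metric.ball p (C * t), (Φ 2 * U.indicator 1 y + Φ τ : ℝ≥0∞) ∂μ :=
          lintegral_mono hpt
      _ = Φ 2 * ∫⁻ y in Metric.ball p (C * t), U.indicator 1 y ∂μ +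
            Φ τ * μ (Metric.ball p (C * t)) := by
          rw [lintegral_add_right _ measurable_const, setLIntegral_const,
            lintegral_const_mul _ (measurable_one.indicator hU.measurableSet)]
      _ ≤ Φ 2 * (θ * μ (Metric.ball p (C * t))) + Φ τ * μ (Metric.ball p (C * t)) := by
          gcongr
          exact lintegral_ball_le_of_notMem_maximalSuperlevel hp
            (Metric.mem_ball_self (by positivity))
      _ = ((Φ 2 * θ + Φ τ : ℝ≥0) : ℝ≥0∞) * μ (Metric.ball p (C * t)) := by push_cast; ring
      _ ≤ v * μ (Metric.ball p (C * t)) := by gcongr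
  refine (hP _ (lipschitzWith_travelCost hx hτ) _ (isUpperGradientOf_travelCost hU hx) p t ht
    (hle.trans_lt ENNReal.coe_lt_top).ne).trans ?_
  rw [mul_comm (κ : ℝ), ENNReal.ofReal_mul ht.le, ENNReal.ofReal_coe_nnreal]
  gcongr
  refine (hΨ.monotone ?_).trans hκ
  simpa using ENNReal.toNNReal_mono ENNReal.coe_ne_top hle

theorem exists_isFragmentConnected (D : ℝ≥0) (Φ Ψ : ℝ≥0 → ℝ≥0) (C : ℝ) (hD : 1 ≤ D)
    (hΦ : IsGauge Φ) (hΨ : IsGauge Ψ) (hC : 1 ≤ C) :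
    ∃ C₁ ε : ℝ, 1 < C₁ ∧ 0 < ε ∧ ε < 1 ∧
      ∀ (X : Type*) [MetricSpace X] [ProperSpace X] [MeasurableSpace X] [BorelSpace X]
        (μ : Measure X), IsDoublingMM μ D → NonhomogeneousPoincare μ Φ Ψ C →
          IsFragmentConnected μ C₁ ε := by
  have hD0 : 0 < D := one_pos.trans_le hD
  -- the oscillation bound `κ` makes the travel cost less than `r / 8`
  obtain ⟨κ, hκ0, hκ⟩ : ∃ κ : ℝ≥0, 0 < κ ∧ 17 * (D : ℝ) ^ 2 * κ = 1 / 8 := by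
    refine ⟨1 / (136 * D ^ 2), by positivity, ?_⟩
    push_cast
    have : (0 : ℝ) < D := hD0
    field_simp
    norm_num
  have small : ∀ {F : ℝ≥0 → ℝ≥0}, IsGauge F → ∀ e : ℝ≥0, 0 < e → ∃ v : ℝ≥0, 0 < v ∧ v < 1 ∧ F v ≤ e := by
    intro F hF e he
    have h1 : ∀ᶠ v in 𝓝[>] (0 : ℝ≥0), F v ≤ e :=
      (hF.tendsto_zero.mono_left nhdsWithin_le_nhds).eventually (Iic_mem_nhds he)
    have h2 : ∀ᶠ v in 𝓝[>] (0 : ℝ≥0), v < 1 :=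
      mem_nhdsWithin_of_mem_nhds (Iio_mem_nhds one_pos)
    obtain ⟨v, ⟨h1, h2⟩, h3⟩ := ((h1.and h2).and self_mem_nhdsWithin).exists
    exact ⟨v, h3, h2, h1⟩
  obtain ⟨v, hv0, -, hv⟩ := small hΨ κ hκ0
  obtain ⟨τ, hτ0, hτ1, hτ⟩ := small hΦ (v / 2) (by positivity)
  obtain ⟨θ, hθ0, hθ1, hθ⟩ : ∃ θ : ℝ≥0, 0 < θ ∧ θ < 1 ∧ Φ 2 * θ ≤ v / 2 := by
    refine ⟨min (1 / 2) (v / 2 / (Φ 2 + 1)), by positivity,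
      (min_le_left _ _).trans_lt (by rw [← NNReal.coe_lt_coe]; norm_num), ?_⟩
    calc Φ 2 * min (1 / 2) (v / 2 / (Φ 2 + 1)) ≤ (Φ 2 + 1) * (v / 2 / (Φ 2 + 1)) := by
          gcongr
          · exact le_self_add
          · exact min_le_right _ _
      _ = v / 2 := by field_simp
  have hvv : Φ 2 * θ + Φ τ ≤ v := (add_le_add hθ hτ).trans_eq (add_halves v)
  have hτ0' : (0 : ℝ) < τ := hτ0
  set C₁ : ℝ := 1 / (8 * τ) + 2 with hC₁
  have hC₁2 : 2 < C₁ := by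
    have : 0 < 1 / (8 * (τ : ℝ)) := by positivity
    linarith
  obtain ⟨m, hm⟩ : ∃ m : ℕ, (C₁ + 1) * 32 < 2 ^ m := pow_unbounded_of_one_lt _ (by norm_num)
  -- `ε` is chosen so that low density of the obstacle at the large scale survives at scale `r / 32`
  set ε : ℝ≥0 := θ / (2 * D ^ (5 + m)) with hε
  have hε0 : 0 < ε := by positivity
  have hεθ : D ^ 5 * (ε * D ^ m) < θ := by
    have : D ^ 5 * (ε * D ^ m) = θ / 2 := by
      rw [hε, pow_add]
      field_simp
    rw [this]
    exact NNReal.half_lt_self hθ0.ne'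
  have hε1 : ε < 1 := by
    refine lt_of_le_of_lt ?_ (hεθ.trans hθ1)
    calc ε = 1 * (ε * 1) := by ring
      _ ≤ D ^ 5 * (ε * D ^ m) := by gcongr <;> exact one_le_pow₀ hD
  refine ⟨C₁, ε, by linarith, hε0, hε1, ?_⟩
  intro X _ _ _ _ μ h hP x y hxy E hE hsmall
  have := h.isLocallyFiniteMeasure
  set r := dist x y with hr
  rw [ENNReal.ofReal_coe_nnreal] at hsmall
  obtain ⟨U, hEU, hUo, hUμ⟩ := (E ∩ Metric.ball x (C₁ * r)).exists_isOpen_lt_of_lt _ hsmall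
  have hρ : 0 < r / 32 := by positivity
  have good : ∀ a : X, dist x a ≤ r →
      ∃ z ∈ Metric.ball a (r / 32), z ∉ maximalSuperlevel μ (U.indicator 1) (θ : ℝ≥0∞) := by
    intro a ha
    refine h.exists_mem_ball_notMem_maximalSuperlevel hD a hρ (s := ε * (D : ℝ≥0∞) ^ m)
      (by exact_mod_cast hεθ) ?_
    rw [lintegral_indicator_one hUo.measurableSet, mul_assoc]
    refine hUμ.le.trans ?_
    gcongr
    refine h.measure_ball_le m hρ ?_
    nlinarith
  obtain ⟨x', hx', hxθ⟩ := good x (by simp [hxy.le])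
  obtain ⟨y', hy', hyθ⟩ := good y le_rfl
  rw [Metric.mem_ball] at hx' hy'
  have hθ1' : (θ : ℝ≥0∞) < 1 := by exact_mod_cast hθ1
  have hx'U := h.notMem_of_notMem_maximalSuperlevel_indicator hUo hθ1' hxθ
  have hy'U := h.notMem_of_notMem_maximalSuperlevel_indicator hUo hθ1' hyθ
  have hcost := h.dist_le_of_oscillation hD (lipschitzWith_travelCost (U := U) hx'U hτ1.le)
    (p := x') (q := y') κ.coe_nonneg
    (fun t ht => hP.oscillation_travelCost_le hΦ hΨ hC hUo hτ1.le hvv hv hx'U hxθ ht)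
    (fun t ht => hP.oscillation_travelCost_le hΦ hΨ hC hUo hτ1.le hvv hv hx'U hyθ ht)
    (t := 2 * r) (by positivity) (by
      rw [dist_comm] at hy'
      linarith [dist_triangle4 x' x y y'])
  rw [travelCost_self hx'U, Real.dist_eq, zero_sub, abs_neg, abs_of_nonneg (travelCost_nonneg _)]
    at hcost
  have hcost' : travelCost U τ x' y' < r / 8 := by
    have h1 : 0 < (D : ℝ) ^ 2 * κ * r := by positivity
    have h2 : 17 * (D : ℝ) ^ 2 * κ * r = 1 / 8 * r := by rw [hκ]
    linarith
  obtain ⟨K, T, γ, gap, hK, hγ0, hγT, hKU, hgap0, hgap, hlt⟩ :=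
    exists_fragment_of_travelCost_lt hx'U hy'U hcost'
  obtain ⟨K₁, γ₁, hK₁, h₁0, h₁T, h₁vol, h₁mem⟩ :=
    (isFragment_singleton x).concat hK (s := r / 32) (by rw [hγ0, dist_comm]; exact hx'.le)
  obtain ⟨K₂, γ₂, hK₂, h₂0, h₂T, h₂vol, h₂mem⟩ :=
    hK₁.concat (isFragment_singleton y) (s := r / 32) (by rw [h₁T, hγT]; exact hy'.le)
  have hT0 := hK.nonneg
  have hTlt : 0 + r / 32 + T + r / 32 + 0 < C₁ * r := by
    have h1 : τ * T < r / 8 := by linarith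
    have h2 : T < 1 / (8 * τ) * r := by
      rw [← mul_lt_mul_iff_right₀ hτ0']
      calc τ * T < r / 8 := h1
        _ = _ := by field_simp
    rw [hC₁, add_mul]
    linarith
  refine ⟨K₂, _, γ₂, hK₂, h₂0.trans h₁0, h₂T, hTlt, ?_, ?_⟩
  · have h1 : volume (Icc 0 (0 + r / 32 + T + r / 32 + 0) \ K₂) ≤
        ENNReal.ofReal (r / 32) + ENNReal.ofReal gap + ENNReal.ofReal (r / 32) := by
      refine h₂vol.trans ?_
      simp only [Icc_self, sdiff_self, measure_empty, add_zero]
      gcongr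
      refine h₁vol.trans ?_
      simp only [Icc_self, sdiff_self, measure_empty, zero_add]
      gcongr
    refine h1.trans_lt ?_
    rw [← ENNReal.ofReal_add hρ.le hgap0, ← ENNReal.ofReal_add (by positivity) hρ.le]
    refine (ENNReal.ofReal_lt_ofReal_iff (by positivity)).2 ?_
    have : 0 ≤ τ * T := by positivity
    linarith
  · intro t ht htE
    have htT : t ≤ 0 + r / 32 + T + r / 32 + 0 := hK₂.isGreatest.2 ht
    have htU : γ₂ t ∈ U := by
      refine hEU ⟨htE, ?_⟩
      have := hK₂.dist_le ht hK₂.isLeast.1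
      rw [h₂0, h₁0, sub_zero, abs_of_nonneg (hK₂.isLeast.2 ht)] at this
      exact Metric.mem_ball.2 (by linarith)
    rcases h₂mem t ht with ⟨ht₁, e₁⟩ | ⟨k, hk, e, -⟩
    · rcases h₁mem t ht₁ with ⟨ht₀, -⟩ | ⟨k, hk, -, e₂⟩
      · exact Or.inl ht₀
      · rw [e₁, e₂] at htU
        exact absurd htU (hKU k hk)
    · exact Or.inr (by rw [e, mem_singleton_iff.1 hk])

/-! ### Increments of functions along fragments -/

/-- A real function which, around each point of `Z`, expands at most by the factor `c` on a sequence
of scales tending to `0`, expands the measure of `Z` at most by `c`. An efficient Besicovitch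
covering makes differentiability unnecessary. -/
theorem volume_image_le_mul_of_frequently {φ : ℝ → ℝ} {Z : Set ℝ} {c : ℝ} (hc : 0 ≤ c)
    (h : ∀ t ∈ Z, ∀ η > 0, ∃ ρ ∈ Ioo 0 η, ∀ u ∈ Z, |u - t| ≤ ρ → |φ u - φ t| ≤ c * ρ) :
    volume (φ '' Z) ≤ ENNReal.ofReal c * volume Z := by
  have key : ∀ ε : ℝ≥0, 0 < ε →
      volume (φ '' Z) ≤ ENNReal.ofReal c * (volume Z + ε) := by
    intro ε hε
    obtain ⟨S, ρ, hS, hSZ, hρ, hcov, hsum⟩ :=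
      Besicovitch.exists_closedBall_covering_tsum_measure_le (volume : Measure ℝ)
        (ε := ε) (by exact_mod_cast hε.ne')
        (fun t => {ρ | 0 < ρ ∧ ∀ u ∈ Z, |u - t| ≤ ρ → |φ u - φ t| ≤ c * ρ}) Z
        (fun t ht η hη => by
          obtain ⟨ρ, hρ, hρ'⟩ := h t ht η hη
          exact ⟨ρ, ⟨hρ.1, hρ'⟩, hρ⟩)
    have hsub : φ '' Z ⊆ ⋃ t ∈ S, Metric.closedBall (φ t) (c * ρ t) := by
      rintro _ ⟨u, hu, rfl⟩
      obtain ⟨t, ht, hut⟩ := mem_iUnion₂.1 (hcov hu)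
      exact mem_biUnion ht (Metric.mem_closedBall.2 ((hρ t ht).2 u hu hut))
    calc volume (φ '' Z) ≤ ∑' t : S, volume (Metric.closedBall (φ t) (c * ρ t)) :=
          (measure_mono hsub).trans (measure_biUnion_le _ hS _)
      _ = ∑' t : S, ENNReal.ofReal c * volume (Metric.closedBall (t : ℝ) (ρ t)) := by
          refine tsum_congr fun t => ?_
          rw [Real.volume_closedBall, Real.volume_closedBall, ← ENNReal.ofReal_mul hc]
          ring_nf
      _ ≤ ENNReal.ofReal c * (volume Z + ε) := by
          rw [ENNReal.tsum_mul_left]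
          gcongr
  have hlim : Tendsto (fun ε : ℝ≥0 => ENNReal.ofReal c * (volume Z + ε)) (𝓝[>] 0)
      (𝓝 (ENNReal.ofReal c * (volume Z + (0 : ℝ≥0)))) := by
    refine ENNReal.Tendsto.const_mul ?_ (Or.inr ENNReal.ofReal_ne_top)
    refine Tendsto.const_add _ ?_
    exact (ENNReal.tendsto_coe.2 tendsto_id).mono_left nhdsWithin_le_nhds
  rw [ENNReal.coe_zero, add_zero] at hlim
  exact ge_of_tendsto hlim (by filter_upwards [self_mem_nhdsWithin] with ε hε using key ε hε)

/-- The increment of `φ` over `[0, T]` is controlled by the measure of `φ '' K` and the increments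
over the gaps of `K`: each value between `φ 0` and `φ T` is either taken on `K` or skipped in a
gap. -/
theorem sub_le_of_volume_image_le {K : Set ℝ} {T : ℝ} {φ : ℝ → ℝ} (hK : IsCompact K)
    (h0 : IsLeast K 0) (hT : IsGreatest K T) (hφ : ContinuousOn φ K) {A N gap : ℝ}
    (hA : 0 ≤ A) (hN : 0 ≤ N) (hgap : 0 ≤ gap) (himage : volume (φ '' K) ≤ ENNReal.ofReal A)
    (hvol : volume (Icc 0 T \ K) ≤ ENNReal.ofReal gap)
    (hjump : ∀ u ∈ K, ∀ v ∈ K, u < v → (∀ t ∈ Ioo u v, t ∉ K) → |φ v - φ u| ≤ N * (v - u)) :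
    φ T - φ 0 ≤ A + N * gap := by
  -- `G` is the set of left end points of gaps, and `ν` gives the right end points
  let G : Set ℝ := {u | u ∈ K ∧ ∃ v ∈ K, u < v ∧ ∀ t ∈ Ioo u v, t ∉ K}
  have hG : ∀ u : ℝ, ∃ v, u ∈ G → v ∈ K ∧ u < v ∧ ∀ t ∈ Ioo u v, t ∉ K := by
    intro u
    by_cases hu : u ∈ G
    · obtain ⟨-, v, hv⟩ := hu
      exact ⟨v, fun _ => hv⟩
    · exact ⟨0, fun h => absurd h hu⟩
  choose ν hν using hG
  have hdisj : G.PairwiseDisjoint fun u => Ioo u (ν u) := by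
    intro u hu w hw huw
    refine Set.disjoint_left.2 fun t htu htw => ?_
    rcases lt_or_gt_of_ne huw with h | h
    · exact (hν u hu).2.2 w ⟨h, htw.1.trans htu.2⟩ hw.1
    · exact (hν w hw).2.2 u ⟨h, htu.1.trans htw.2⟩ hu.1
  have hcount : G.Countable := hdisj.countable_of_Ioo fun u hu => (hν u hu).2.1
  have hcover : Icc (φ 0) (φ T) ⊆ φ '' K ∪ ⋃ u ∈ G, Icc (φ u) (φ (ν u)) := by
    rintro y ⟨hy0, hyT⟩
    have hcomp : IsCompact (K ∩ φ ⁻¹' Iic y) :=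
      hK.of_isClosed_subset (hφ.preimage_isClosed_of_isClosed hK.isClosed isClosed_Iic)
        inter_subset_left
    obtain ⟨u, ⟨huK, huy⟩, humax⟩ := hcomp.exists_isGreatest ⟨0, h0.1, hy0⟩
    rcases eq_or_lt_of_le (show φ u ≤ y from huy) with h | h
    · exact Or.inl ⟨u, huK, h⟩
    have habove : ∀ t ∈ K, u < t → y < φ t := fun t ht hut =>
      not_le.1 fun hle => (humax ⟨ht, hle⟩).not_gt hut
    have huT : u < T := by
      refine lt_of_le_of_ne (hT.2 huK) ?_
      rintro rfl
      exact h.not_ge hyT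
    -- by continuity, `u` is isolated in `K` from the right
    obtain ⟨η, hη, hηK⟩ : ∃ η > u, ∀ t ∈ K, u < t → η ≤ t := by
      have hev : ∀ᶠ t in 𝓝[K] u, φ t < y := (hφ u huK).eventually (Iio_mem_nhds h)
      obtain ⟨δ, hδ, hball⟩ := Metric.mem_nhdsWithin_iff.1 hev
      refine ⟨u + δ, by linarith, fun t ht hut => ?_⟩
      by_contra! hlt
      refine (habove t ht hut).not_gt (hball ⟨?_, ht⟩)
      rw [Metric.mem_ball, Real.dist_eq, abs_of_pos (by linarith)]
      linarith
    obtain ⟨v, ⟨hvK, hvη⟩, hvmin⟩ := (hK.inter_right (isClosed_Ici (a := η))).exists_isLeast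
      ⟨T, hT.1, hηK T hT.1 huT⟩
    have huv : u < v := hη.trans_le hvη
    have huG : u ∈ G := ⟨huK, v, hvK, huv, fun t ht htK =>
      (hvmin ⟨htK, hηK t htK ht.1⟩).not_gt ht.2⟩
    exact Or.inr (mem_biUnion huG ⟨h.le, (habove _ (hν u huG).1 (hν u huG).2.1).le⟩)
  have hgaps : ∑' u : G, volume (Ioo (u : ℝ) (ν u)) ≤ ENNReal.ofReal gap := by
    rw [← measure_biUnion hcount hdisj fun _ _ => measurableSet_Ioo]
    refine (measure_mono (iUnion₂_subset fun u hu t ht => ?_)).trans hvol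
    exact ⟨⟨(h0.2 hu.1).trans ht.1.le, ht.2.le.trans (hT.2 (hν u hu).1)⟩, (hν u hu).2.2 t ht⟩
  have hfin : ENNReal.ofReal (φ T - φ 0) ≤ ENNReal.ofReal (A + N * gap) := by
    calc ENNReal.ofReal (φ T - φ 0) = volume (Icc (φ 0) (φ T)) := Real.volume_Icc.symm
      _ ≤ volume (φ '' K) + ∑' u : G, volume (Icc (φ u) (φ (ν u))) :=
          (measure_mono hcover).trans ((measure_union_le _ _).trans (by
            gcongr
            exact measure_biUnion_le _ hcount _))
      _ ≤ ENNReal.ofReal A + ∑' u : G, ENNReal.ofReal N * volume (Ioo (u : ℝ) (ν u)) := by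
          gcongr with u
          rw [Real.volume_Icc, Real.volume_Ioo, ← ENNReal.ofReal_mul hN]
          obtain ⟨h1, h2, h3⟩ := hν u u.2
          exact ENNReal.ofReal_le_ofReal ((le_abs_self _).trans (hjump u u.2.1 _ h1 h2 h3))
      _ ≤ ENNReal.ofReal A + ENNReal.ofReal N * ENNReal.ofReal gap := by
          rw [ENNReal.tsum_mul_left]
          gcongr
      _ = ENNReal.ofReal (A + N * gap) := by
          rw [← ENNReal.ofReal_mul hN, ← ENNReal.ofReal_add hA (by positivity)]
  rwa [ENNReal.ofReal_le_ofReal_iff (by positivity)] at hfin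

/-! ### The lower pointwise Lipschitz constant -/

section lowerLip

variable {X Y Z : Type*} [MetricSpace X] [MetricSpace Y] [MetricSpace Z]

/-- The oscillation `sup_{y ∈ B(x, r)} d(f x, f y)`, relative to the radius `r`. -/
noncomputable def ballSlope (f : X → Y) (r : ℝ) (x : X) : ℝ≥0∞ :=
  (⨆ y ∈ Metric.ball x r, edist (f x) (f y)) / ENNReal.ofReal r

theorem measurable_ballSlope [MeasurableSpace X] [BorelSpace X] {f : X → Y} (hf : Continuous f)
    (r : ℝ) : Measurable (ballSlope f r) := by
  refine Measurable.div_const ?_ _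
  refine measurable_of_Ioi fun c => IsOpen.measurableSet ?_
  have : (fun x => ⨆ y ∈ Metric.ball x r, edist (f x) (f y)) ⁻¹' Ioi c =
      ⋃ y : X, {x | dist y x < r} ∩ {x | c < edist (f x) (f y)} := by
    ext x
    simp [lt_iSup_iff]
  rw [this]
  exact isOpen_iUnion fun y => (isOpen_lt (by fun_prop) continuous_const).inter
    (isOpen_lt continuous_const (by fun_prop))

/-- Rational radii suffice in the definition of `lowerLip`, because the numerator of `ballSlope` is
monotone in the radius. -/
theorem lowerLip_eq_iSup_iInf (f : X → Y) (x : X) :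
    lowerLip f x = ⨆ n : ℕ, ⨅ r : {q : ℚ // (q : ℝ) ∈ Ioo (0 : ℝ) (1 / (n + 1))},
      ballSlope f (r : ℚ) x := by
  have e : lowerLip f x = ⨆ (η : ℝ) (_ : 0 < η), ⨅ r ∈ Ioo 0 η, ballSlope f r x :=
    (nhdsGT_basis (0 : ℝ)).liminf_eq_iSup_iInf
  rw [e]
  refine le_antisymm (iSup₂_le fun η hη => ?_) (iSup_le fun n => ?_)
  · obtain ⟨n, hn⟩ := exists_nat_one_div_lt hη
    exact le_iSup_of_le n (le_iInf fun q => iInf₂_le _ ⟨q.2.1, q.2.2.trans hn⟩)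
  · refine le_iSup₂_of_le (1 / (n + 1 : ℝ)) (by positivity) (le_iInf₂ fun r hr => ?_)
    by_contra! hlt
    have hcont : Tendsto (fun t : ℝ => (⨆ y ∈ Metric.ball x r, edist (f x) (f y)) /
        ENNReal.ofReal t) (𝓝[<] r) (𝓝 (ballSlope f r x)) :=
      ENNReal.Tendsto.const_div
        ((ENNReal.continuous_ofReal.tendsto r).mono_left nhdsWithin_le_nhds)
        (Or.inl ENNReal.ofReal_ne_top)
    obtain ⟨l, hl, hsub⟩ :=
      (mem_nhdsLT_iff_exists_Ioo_subset' hr.1).1 (hcont.eventually (Iio_mem_nhds hlt))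
    obtain ⟨q, hq1, hq2⟩ := exists_rat_btwn (max_lt hl hr.1)
    rw [max_lt_iff] at hq1
    have hlt' : (⨆ y ∈ Metric.ball x r, edist (f x) (f y)) / ENNReal.ofReal q <
        ⨅ q : {q : ℚ // (q : ℝ) ∈ Ioo (0 : ℝ) (1 / (n + 1))}, ballSlope f (q : ℚ) x :=
      hsub ⟨hq1.1, hq2⟩
    refine hlt'.not_ge ?_
    refine (iInf_le _ (⟨q, hq1.2, hq2.trans hr.2⟩ :
      {q : ℚ // (q : ℝ) ∈ Ioo (0 : ℝ) (1 / (n + 1))})).trans ?_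
    exact ENNReal.div_le_div_right
      (biSup_mono fun y hy => Metric.ball_subset_ball hq2.le hy) _

theorem measurable_lowerLip [MeasurableSpace X] [BorelSpace X] {f : X → Y} (hf : Continuous f) :
    Measurable (lowerLip f) := by
  have : lowerLip f = fun x => ⨆ n : ℕ, ⨅ r : {q : ℚ // (q : ℝ) ∈ Ioo (0 : ℝ) (1 / (n + 1))},
      ballSlope f (r : ℚ) x := funext (lowerLip_eq_iSup_iInf f)
  rw [this]
  exact Measurable.iSup fun n => Measurable.iInf fun r => measurable_ballSlope hf _

theorem lowerLip_comp_le {f : X → Y} {g : Y → Z} (hg : LipschitzWith 1 g) (x : X) :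
    lowerLip (g ∘ f) x ≤ lowerLip f x := by
  refine liminf_le_liminf (Eventually.of_forall fun r => ?_)
  exact ENNReal.div_le_div_right (iSup₂_mono fun y _ => by simpa using hg (f x) (f y)) _

/-- At a point where the lower Lipschitz constant is at most `s`, there are arbitrarily small closed
balls on which the function oscillates at most by `2 s` times the radius. -/
theorem exists_small_radius_of_lowerLip_le {h : X → ℝ} {x : X} {s : ℝ} (hs : 0 < s)
    (hx : lowerLip h x ≤ ENNReal.ofReal s) {η : ℝ} (hη : 0 < η) :
    ∃ ρ ∈ Ioo 0 η, ∀ y, dist y x ≤ ρ → |h y - h x| ≤ 2 * s * ρ := by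
  have hlt : lowerLip h x < ENNReal.ofReal (3 / 2 * s) :=
    hx.trans_lt ((ENNReal.ofReal_lt_ofReal_iff (by positivity)).2 (by linarith))
  have hfreq := frequently_lt_of_liminf_lt (by isBoundedDefault) hlt
  have hev : ∀ᶠ r in 𝓝[>] (0 : ℝ), r ∈ Ioo 0 η := Ioo_mem_nhdsGT hη
  obtain ⟨r, hr, hr0, hrη⟩ := (hfreq.and_eventually hev).exists
  refine ⟨3 / 4 * r, ⟨by positivity, by linarith⟩, fun y hy => ?_⟩
  have hyb : y ∈ Metric.ball x r := Metric.mem_ball.2 (by linarith)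
  have h1 : edist (h x) (h y) / ENNReal.ofReal r ≤ ENNReal.ofReal (3 / 2 * s) :=
    le_trans (by gcongr; exact le_iSup₂ (f := fun y _ => edist (h x) (h y)) y hyb) hr.le
  rw [ENNReal.div_le_iff (by simpa using hr0) ENNReal.ofReal_ne_top, edist_dist,
    ← ENNReal.ofReal_mul (by positivity), ENNReal.ofReal_le_ofReal_iff (by positivity),
    Real.dist_eq, abs_sub_comm] at h1
  linarith

end lowerLip

/-! ### Self-improvement along fragments -/

section

variable {X : Type*} [MetricSpace X] [MeasurableSpace X] [BorelSpace X] [SecondCountableTopology X]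
  {μ : Measure X} {D : ℝ≥0}

/-- The obstacle of points where the maximal function of `G`, or `G` itself, exceeds `2 ^ q * S` has
small density in a ball around a point where the maximal function is at most `S`. -/
theorem IsDoublingMM.measure_obstacle_lt (h : IsDoublingMM μ D) (hD : 1 ≤ D) {ε : ℝ} {q : ℕ}
    (hq : 2 * (D : ℝ≥0∞) ^ 5 < ENNReal.ofReal ε * 2 ^ q) {G : X → ℝ≥0∞} (hG : Measurable G)
    {S : ℝ≥0∞} (hS0 : S ≠ 0) (hS1 : S ≠ ∞) {a : X} (ha : a ∉ maximalSuperlevel μ G S) {ρ : ℝ}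
    (hρ : 0 < ρ) :
    μ ((maximalSuperlevel μ G (2 ^ q * S) ∪ {z | 2 ^ q * S < G z}) ∩ Metric.ball a ρ) <
      ENNReal.ofReal ε * μ (Metric.ball a ρ) := by
  have hD' : (1 : ℝ≥0∞) ≤ D := by exact_mod_cast hD
  have hav : ∀ t, ρ ≤ t → ∫⁻ y in Metric.ball a t, G y ∂μ ≤ S * μ (Metric.ball a t) :=
    fun t ht => lintegral_ball_le_of_notMem_maximalSuperlevel ha
      (Metric.mem_ball_self (hρ.trans_le ht))
  have h1 := measure_ball_inter_maximalSuperlevel_le h hD a hρ (2 ^ q * S) hav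
  have h2 : 2 ^ q * S * μ ({z | 2 ^ q * S < G z} ∩ Metric.ball a ρ) ≤ S * μ (Metric.ball a ρ) := by
    refine le_trans ?_ (hav ρ le_rfl)
    refine le_trans ?_ (mul_meas_ge_le_lintegral hG (2 ^ q * S))
    rw [Measure.restrict_apply (measurableSet_le measurable_const hG)]
    refine mul_le_mul' le_rfl (measure_mono (inter_subset_inter_left _ ?_))
    exact fun z (hz : 2 ^ q * S < G z) => hz.le
  refine lt_of_mul_lt_mul_left' (a := 2 ^ q * S) ?_
  calc 2 ^ q * S * μ ((maximalSuperlevel μ G (2 ^ q * S) ∪ {z | 2 ^ q * S < G z}) ∩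
        Metric.ball a ρ)
      ≤ 2 ^ q * S * (μ (Metric.ball a ρ ∩ maximalSuperlevel μ G (2 ^ q * S)) +
          μ ({z | 2 ^ q * S < G z} ∩ Metric.ball a ρ)) := by
        rw [union_inter_distrib_right, inter_comm (Metric.ball a ρ)]
        gcongr
        exact measure_union_le _ _
    _ ≤ (D : ℝ≥0∞) ^ 5 * S * μ (Metric.ball a ρ) + (D : ℝ≥0∞) ^ 5 * S * μ (Metric.ball a ρ) := by
        rw [mul_add]
        refine add_le_add h1 (h2.trans ?_)
        gcongr
        exact le_mul_of_one_le_left' (one_le_pow₀ hD')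
    _ = (2 * (D : ℝ≥0∞) ^ 5) * (S * μ (Metric.ball a ρ)) := by ring
    _ < (ENNReal.ofReal ε * 2 ^ q) * (S * μ (Metric.ball a ρ)) :=
        ENNReal.mul_lt_mul_left (mul_ne_zero hS0 (h.measure_ball_pos a ρ hρ).ne')
          (ENNReal.mul_ne_top hS1 (h.measure_ball_lt_top a ρ hρ).ne) hq
    _ = _ := by ring

/-- The self-improvement step, iterated `n` times. A fragment avoiding the points where `G` or its
maximal function exceeds `(2 s) ^ q` has gaps of total length at most `d(a, b) / 4`, and the end
points of its gaps satisfy the hypotheses again with `2 s` in place of `s`. Since `2 / 4 < 1` the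
contributions of all generations add up, and the Lipschitz constant `L` of `f` is only used on the
gaps of the last generation. -/
theorem IsFragmentConnected.abs_sub_le_add (h : IsDoublingMM μ D) (hD : 1 ≤ D) {C ε : ℝ}
    (hconn : IsFragmentConnected μ C ε) (hC : 1 < C) {q : ℕ} (hq0 : q ≠ 0)
    (hq : 2 * (D : ℝ≥0∞) ^ 5 < ENNReal.ofReal ε * 2 ^ q) {f : X → ℝ} {L : ℝ≥0}
    (hf : LipschitzWith L f) {G : X → ℝ≥0∞} (hG : Measurable G) {B : Set X}
    (hGB : ∀ z ∈ B, lowerLip f z ^ q ≤ G z) (n : ℕ) :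
    ∀ s : ℝ, 0 < s → ∀ a b : X, Metric.ball a (2 * C * dist a b) ⊆ B →
      a ∉ maximalSuperlevel μ G (ENNReal.ofReal s ^ q) →
      b ∉ maximalSuperlevel μ G (ENNReal.ofReal s ^ q) →
      |f a - f b| ≤ (8 * C * s + L * (1 / 4) ^ n) * dist a b := by
  induction n with
  | zero =>
    intro s hs a b _ _ _
    have h1 := hf.dist_le_mul a b
    rw [Real.dist_eq] at h1
    have h2 : 0 ≤ 8 * C * s * dist a b := by positivity
    rw [pow_zero, mul_one, add_mul]
    linarith
  | succ n ih =>
    intro s hs a b hB ha hb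
    rcases eq_or_ne a b with rfl | hab
    · simp
    have hd : 0 < dist a b := dist_pos.2 hab
    set d := dist a b with hd_def
    have hσ : ENNReal.ofReal (2 * s) ^ q = 2 ^ q * ENNReal.ofReal s ^ q := by
      rw [ENNReal.ofReal_mul zero_le_two, mul_pow]
      simp
    have hsσ : ENNReal.ofReal s ^ q ≤ ENNReal.ofReal (2 * s) ^ q := by
      gcongr
      linarith
    set E : Set X := maximalSuperlevel μ G (ENNReal.ofReal (2 * s) ^ q) ∪
      {z | ENNReal.ofReal (2 * s) ^ q < G z} with hE
    have hEm : MeasurableSet E :=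
      (isOpen_maximalSuperlevel _).measurableSet.union (measurableSet_lt measurable_const hG)
    have hEsmall : μ (E ∩ Metric.ball a (C * d)) <
        ENNReal.ofReal ε * μ (Metric.ball a (C * d)) := by
      rw [hE, hσ]
      exact h.measure_obstacle_lt hD hq hG (pow_ne_zero _ (by simpa using hs))
        (ENNReal.pow_ne_top ENNReal.ofReal_ne_top) ha (by positivity)
    obtain ⟨K, T, γ, hK, hγ0, hγT, hTC, hgap, havoid⟩ := hconn a b hd E hEm hEsmall
    have hT0 := hK.nonneg
    have hball : ∀ t ∈ K, dist (γ t) a < C * d := by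
      intro t ht
      have h1 := hK.dist_le ht hK.isLeast.1
      have h2 := hK.isGreatest.2 ht
      rw [hγ0, sub_zero, abs_of_nonneg (hK.isLeast.2 ht)] at h1
      linarith
    have hγB : ∀ t ∈ K, γ t ∈ B := fun t ht => hB (Metric.mem_ball.2 (by
      have : 0 < C * d := by positivity
      linarith [hball t ht]))
    have hmax : ∀ t ∈ K, γ t ∉ maximalSuperlevel μ G (ENNReal.ofReal (2 * s) ^ q) := by
      intro t ht hmem
      rcases havoid t ht (Or.inl hmem) with rfl | rfl
      · exact ha (maximalSuperlevel_anti hsσ (hγ0 ▸ hmem))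
      · exact hb (maximalSuperlevel_anti hsσ (hγT ▸ hmem))
    have hlip : ∀ t ∈ K \ {0, T}, lowerLip f (γ t) ≤ ENNReal.ofReal (2 * s) := by
      rintro t ⟨ht, ht'⟩
      have h1 : ¬ ENNReal.ofReal (2 * s) ^ q < G (γ t) := fun hlt =>
        ht' (by simpa using havoid t ht (Or.inr hlt))
      exact (ENNReal.pow_le_pow_left_iff hq0).1 ((hGB _ (hγB t ht)).trans (not_lt.1 h1))
    have hN : 0 ≤ 8 * C * (2 * s) + L * (1 / 4) ^ n := by positivity
    have hjump : ∀ u ∈ K, ∀ v ∈ K, u < v → (∀ t ∈ Ioo u v, t ∉ K) →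
        |f (γ v) - f (γ u)| ≤ (8 * C * (2 * s) + L * (1 / 4) ^ n) * (v - u) := by
      intro u hu v hv huv hgapuv
      have hlen : v - u < 1 / 4 * d := by
        have h1 : volume (Ioo u v) ≤ volume (Icc 0 T \ K) := measure_mono fun t ht =>
          ⟨⟨(hK.isLeast.2 hu).trans ht.1.le, ht.2.le.trans (hK.isGreatest.2 hv)⟩, hgapuv t ht⟩
        rw [Real.volume_Ioo] at h1
        exact (ENNReal.ofReal_lt_ofReal_iff (by positivity)).1 (h1.trans_lt hgap)
      have hdist : dist (γ u) (γ v) ≤ v - u := by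
        have := hK.dist_le hu hv
        rwa [abs_sub_comm, abs_of_pos (sub_pos.2 huv)] at this
      rw [abs_sub_comm]
      refine (ih (2 * s) (by positivity) (γ u) (γ v) ?_ (hmax u hu) (hmax v hv)).trans
        (mul_le_mul_of_nonneg_left hdist hN)
      refine (Metric.ball_subset_ball' ?_).trans hB
      have h1 : 2 * C * dist (γ u) (γ v) ≤ 2 * C * (1 / 4 * d) := by
        gcongr
        linarith
      have h2 : 0 < C * d := by positivity
      linarith [hball u hu]
    -- the one-dimensional estimate, applied to `f ∘ γ` and to its negative
    have main : ∀ ψ : ℝ → ℝ, (∀ u v, |ψ u - ψ v| = |f (γ u) - f (γ v)|) →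
        ψ T - ψ 0 ≤ (8 * C * s + L * (1 / 4) ^ (n + 1)) * d := by
      intro ψ hψ
      have hcont : ContinuousOn ψ K := by
        refine LipschitzOnWith.continuousOn (K := L) (LipschitzOnWith.of_dist_le_mul ?_)
        intro u hu v hv
        rw [Real.dist_eq, hψ, ← Real.dist_eq]
        refine (hf.dist_le_mul _ _).trans ?_
        gcongr
        exact hK.dist_le hu hv
      have himage : volume (ψ '' K) ≤ ENNReal.ofReal (4 * s * (C * d)) := by
        have h1 : volume (ψ '' (K \ {0, T})) ≤
            ENNReal.ofReal (4 * s) * volume (K \ {0, T}) := by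
          refine volume_image_le_mul_of_frequently (by positivity) fun t ht η hη => ?_
          obtain ⟨ρ, hρ, hosc⟩ :=
            exists_small_radius_of_lowerLip_le (by positivity) (hlip t ht) hη
          refine ⟨ρ, hρ, fun u hu hut => ?_⟩
          rw [hψ]
          refine (hosc (γ u) ((hK.dist_le hu.1 ht.1).trans hut)).trans_eq ?_
          ring
        have h2 : volume (ψ '' {0, T}) = 0 :=
          ((toFinite ({0, T} : Set ℝ)).image ψ).measure_zero _
        calc volume (ψ '' K) ≤ volume (ψ '' (K \ {0, T}) ∪ ψ '' {0, T}) := by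
              rw [← image_union]
              exact measure_mono (image_mono (sdiff_union_self.symm ▸ subset_union_left))
          _ ≤ ENNReal.ofReal (4 * s) * volume (K \ {0, T}) + 0 :=
              (measure_union_le _ _).trans (add_le_add h1 h2.le)
          _ ≤ ENNReal.ofReal (4 * s) * volume (Icc 0 T) := by
              rw [add_zero]
              gcongr
              exact fun t ht => ⟨hK.isLeast.2 ht.1, hK.isGreatest.2 ht.1⟩
          _ ≤ ENNReal.ofReal (4 * s * (C * d)) := by
              rw [Real.volume_Icc, ← ENNReal.ofReal_mul (by positivity)]
              gcongr
              linarith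
      have := sub_le_of_volume_image_le hK.isCompact hK.isLeast hK.isGreatest hcont
        (by positivity) hN (by positivity) himage hgap.le
        (fun u hu v hv huv hg => (hψ v u).trans_le (hjump u hu v hv huv hg))
      refine this.trans_eq ?_
      rw [pow_succ]
      ring
    have h1 := main (fun t => f (γ t)) fun _ _ => rfl
    have h2 := main (fun t => -f (γ t)) fun u v => by
      rw [← abs_neg]
      ring_nf
    simp only [hγ0, hγT] at h1 h2
    exact abs_sub_le_iff.2 ⟨by linarith, h1⟩

/-- The pointwise estimate: the increment of `f` is bounded by the maximal function of the `q`-th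
power of its lower Lipschitz constant. -/
theorem IsFragmentConnected.abs_sub_le (h : IsDoublingMM μ D) (hD : 1 ≤ D) {C ε : ℝ}
    (hconn : IsFragmentConnected μ C ε) (hC : 1 < C) {q : ℕ} (hq0 : q ≠ 0)
    (hq : 2 * (D : ℝ≥0∞) ^ 5 < ENNReal.ofReal ε * 2 ^ q) {f : X → ℝ} {L : ℝ≥0}
    (hf : LipschitzWith L f) {G : X → ℝ≥0∞} (hG : Measurable G) {B : Set X}
    (hGB : ∀ z ∈ B, lowerLip f z ^ q ≤ G z) {s : ℝ} (hs : 0 < s) {a b : X}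
    (hab : Metric.ball a (2 * C * dist a b) ⊆ B)
    (ha : a ∉ maximalSuperlevel μ G (ENNReal.ofReal s ^ q))
    (hb : b ∉ maximalSuperlevel μ G (ENNReal.ofReal s ^ q)) :
    |f a - f b| ≤ 8 * C * s * dist a b := by
  have hlim : Tendsto (fun n : ℕ => (8 * C * s + L * (1 / 4 : ℝ) ^ n) * dist a b) atTop
      (𝓝 ((8 * C * s + L * 0) * dist a b)) :=
    (((tendsto_pow_atTop_nhds_zero_of_lt_one (by norm_num) (by norm_num)).const_mul _).const_add
      _).mul_const _
  rw [mul_zero, add_zero] at hlim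
  exact ge_of_tendsto' hlim fun n =>
    hconn.abs_sub_le_add h hD hC hq0 hq hf hG hGB n s hs a b hab ha hb

end

/-! ### The Poincaré inequality -/

section

variable {X : Type*} [MetricSpace X] [ProperSpace X] [MeasurableSpace X] [BorelSpace X]
  {μ : Measure X} {D : ℝ≥0}

/-- Integration of the pointwise estimate against the weak type bound, which converges because the
maximal function enters with the power `1 / q < 1`. -/
theorem IsFragmentConnected.oscillation_le (h : IsDoublingMM μ D) (hD : 1 ≤ D) {C ε : ℝ}
    (hconn : IsFragmentConnected μ C ε) (hC : 1 < C) (hε : ε < 1) {q : ℕ} (hq2 : 2 ≤ q)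
    (hq : 2 * (D : ℝ≥0∞) ^ 5 < ENNReal.ofReal ε * 2 ^ q) {F : Type*} [NormedAddCommGroup F]
    [NormedSpace ℝ F] [CompleteSpace F] {f : X → F} {L : ℝ≥0} (hf : LipschitzWith L f) {x : X}
    {r s : ℝ} (hr : 0 < r) (hs : 0 < s)
    (hfs : ∫⁻ y in Metric.ball x ((4 * C + 1) * r), lowerLip f y ^ q ∂μ ≤
      ENNReal.ofReal s ^ q * μ (Metric.ball x r)) :
    ⨍⁻ y in Metric.ball x r, edist (f y) (⨍ z in Metric.ball x r, f z ∂μ) ∂μ ≤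
      ENNReal.ofReal (128 * C * D ^ 5 * r * s) := by
  set B := Metric.ball x r with hB
  have hB0 : μ B ≠ 0 := (h.measure_ball_pos x r hr).ne'
  have hB1 : μ B ≠ ∞ := (h.measure_ball_lt_top x r hr).ne
  set B' := Metric.ball x ((4 * C + 1) * r) with hB'
  set G : X → ℝ≥0∞ := B'.indicator fun y => lowerLip f y ^ q with hG
  have hGm : Measurable G :=
    ((measurable_lowerLip hf.continuous).pow_const q).indicator measurableSet_ball
  have hGint : ∫⁻ y, G y ∂μ ≤ ENNReal.ofReal s ^ q * μ B := by
    rwa [hG, lintegral_indicator measurableSet_ball]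
  -- the superlevel sets of the maximal function at the heights `(2 ^ (k + 1) s) ^ q`
  set E : ℕ → Set X := fun k => maximalSuperlevel μ G (ENNReal.ofReal (2 ^ (k + 1) * s) ^ q) with hE
  have hEanti : ∀ k, E k ⊆ E 0 := fun k => maximalSuperlevel_anti (by
    gcongr <;> norm_num)
  have hweak : ∀ k, (2 ^ q) ^ (k + 1) * μ (B ∩ E k) ≤ (D : ℝ≥0∞) ^ 5 * μ B := by
    intro k
    have h1 := measure_ball_inter_maximalSuperlevel_le (G := G) h hD x hr
      (ENNReal.ofReal (2 ^ (k + 1) * s) ^ q) fun t ht =>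
        (setLIntegral_le_lintegral _ _).trans
          (hGint.trans (mul_le_mul' le_rfl (measure_mono (Metric.ball_subset_ball ht))))
    have hs' : ENNReal.ofReal s ^ q ≠ 0 := pow_ne_zero _ (by simpa using hs)
    refine (ENNReal.mul_le_mul_iff_right hs'
      (ENNReal.pow_ne_top ENNReal.ofReal_ne_top)).1 ?_
    calc ENNReal.ofReal s ^ q * ((2 ^ q) ^ (k + 1) * μ (B ∩ E k))
        = ENNReal.ofReal (2 ^ (k + 1) * s) ^ q * μ (B ∩ E k) := by
          rw [ENNReal.ofReal_mul (by positivity), ENNReal.ofReal_pow zero_le_two,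
            ENNReal.ofReal_ofNat, mul_pow, ← pow_mul, ← pow_mul, mul_comm q]
          ring
      _ ≤ _ := h1.trans_eq (by ring)
  -- a base point outside of the lowest superlevel set
  obtain ⟨b, hbB, hbE⟩ : ∃ b ∈ B, b ∉ E 0 := by
    by_contra! hcon
    have h1 := hweak 0
    rw [inter_eq_left.2 hcon, zero_add, pow_one,
      ENNReal.mul_le_mul_iff_left hB0 hB1] at h1
    refine hq.not_ge ?_
    calc ENNReal.ofReal ε * 2 ^ q ≤ 1 * (D : ℝ≥0∞) ^ 5 := by
          gcongr
          exact ENNReal.ofReal_le_one.2 hε.le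
      _ ≤ 2 * (D : ℝ≥0∞) ^ 5 := by gcongr; norm_num
  set W := ENNReal.ofReal (16 * C * s * r) with hW
  have hlevel : ∀ a ∈ B, ∀ k, a ∉ E k → edist (f a) (f b) ≤ W * 2 ^ (k + 1) := by
    intro a ha k hk
    have hab : dist a b < 2 * r := by
      have := dist_triangle_right a b x
      rw [hB, Metric.mem_ball] at ha hbB
      linarith
    have hlip : LipschitzWith L fun y => dist (f y) (f b) := by
      have := (LipschitzWith.dist_left (f b)).comp hf
      rwa [one_mul] at this
    have h1 := hconn.abs_sub_le h hD hC (by omega) hq hlip hGm (B := B') (fun z hz => by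
      rw [hG, indicator_of_mem hz]
      gcongr
      exact lowerLip_comp_le (LipschitzWith.dist_left (f b)) z) (s := 2 ^ (k + 1) * s)
      (by positivity) (a := a) (b := b) (Metric.ball_subset_ball' (by
        have h1 : 2 * C * dist a b ≤ 2 * C * (2 * r) := by gcongr
        have h2 := Metric.mem_ball.1 ha
        linarith)) hk (fun hb => hbE (hEanti k hb))
    rw [dist_self, sub_zero, abs_of_nonneg dist_nonneg] at h1
    rw [edist_dist, hW, ← ENNReal.ofReal_ofNat, ← ENNReal.ofReal_pow zero_le_two,
      ← ENNReal.ofReal_mul (by positivity)]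
    refine ENNReal.ofReal_le_ofReal (h1.trans ?_)
    calc 8 * C * (2 ^ (k + 1) * s) * dist a b ≤ 8 * C * (2 ^ (k + 1) * s) * (2 * r) := by gcongr
      _ = _ := by ring
  have hpt : ∀ a ∈ B, edist (f a) (f b) ≤
      W * (2 + ∑' k, (E k).indicator (fun _ => (2 : ℝ≥0∞) ^ (k + 2)) a) := by
    classical
    intro a ha
    by_cases hex : ∃ k, a ∉ E k
    · rcases Nat.eq_zero_or_pos (Nat.find hex) with h0 | hpos
      · refine (hlevel a ha 0 (h0 ▸ Nat.find_spec hex)).trans ?_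
        gcongr
        simp
      · obtain ⟨j, hj⟩ := Nat.exists_eq_succ_of_ne_zero hpos.ne'
        have hjE : a ∈ E j := not_not.1 (Nat.find_min hex (by omega))
        refine (hlevel a ha _ (Nat.find_spec hex)).trans ?_
        gcongr
        refine le_add_left (le_trans ?_ (ENNReal.le_tsum j))
        rw [indicator_of_mem hjE, hj]
    · push Not at hex
      have htop : ∑' k, (E k).indicator (fun _ => (2 : ℝ≥0∞) ^ (k + 2)) a = ∞ := by
        refine top_unique ?_
        rw [← ENNReal.tsum_const_eq_top_of_ne_zero (α := ℕ) (one_ne_zero)]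
        refine ENNReal.tsum_le_tsum fun k => ?_
        rw [indicator_of_mem (hex k)]
        exact one_le_pow₀ (by norm_num)
      rw [htop, add_top, ENNReal.mul_top (by
        rw [hW]; exact (ENNReal.ofReal_pos.2 (by positivity)).ne')]
      exact le_top
  have hterm : ∀ k, 2 ^ (k + 2) * μ (B ∩ E k) ≤ (D : ℝ≥0∞) ^ 5 * μ B * 2⁻¹ ^ k := by
    intro k
    have h2 : (2 : ℝ≥0∞) ^ k * 2⁻¹ ^ k = 1 := by
      rw [← mul_pow, ENNReal.mul_inv_cancel (by norm_num) (by norm_num), one_pow]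
    have h4 : (2 : ℝ≥0∞) ^ (k + 2) * 2 ^ k = (2 ^ 2) ^ (k + 1) := by
      rw [← pow_mul, ← pow_add]
      congr 1
      omega
    calc 2 ^ (k + 2) * μ (B ∩ E k) = 2 ^ (k + 2) * μ (B ∩ E k) * (2 ^ k * 2⁻¹ ^ k) := by
          rw [h2, mul_one]
      _ = (2 ^ 2) ^ (k + 1) * μ (B ∩ E k) * 2⁻¹ ^ k := by
          rw [← h4]
          ring
      _ ≤ (2 ^ q) ^ (k + 1) * μ (B ∩ E k) * 2⁻¹ ^ k := by
          gcongr
          norm_num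
      _ ≤ _ := mul_le_mul' (hweak k) le_rfl
  have hint : ∫⁻ a in B, edist (f a) (f b) ∂μ ≤ 4 * (D : ℝ≥0∞) ^ 5 * W * μ B := by
    have hEm : ∀ k, MeasurableSet (E k) := fun k => (isOpen_maximalSuperlevel _).measurableSet
    calc ∫⁻ a in B, edist (f a) (f b) ∂μ
        ≤ ∫⁻ a in B, W * (2 + ∑' k, (E k).indicator (fun _ => (2 : ℝ≥0∞) ^ (k + 2)) a) ∂μ :=
          setLIntegral_mono' measurableSet_ball hpt
      _ = W * (2 * μ B + ∑' k, 2 ^ (k + 2) * μ (B ∩ E k)) := by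
          rw [lintegral_const_mul' _ _ ENNReal.ofReal_ne_top, lintegral_add_left measurable_const,
            setLIntegral_const, lintegral_tsum fun k =>
              (measurable_const.indicator (hEm k)).aemeasurable]
          congr 3
          ext k
          rw [lintegral_indicator (hEm k), setLIntegral_const, Measure.restrict_apply (hEm k),
            inter_comm]
      _ ≤ W * (2 * ((D : ℝ≥0∞) ^ 5 * μ B) + ∑' k, (D : ℝ≥0∞) ^ 5 * μ B * 2⁻¹ ^ k) := by
          refine mul_le_mul' le_rfl (add_le_add (mul_le_mul' le_rfl ?_)
            (ENNReal.tsum_le_tsum hterm))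
          exact le_mul_of_one_le_left' (one_le_pow₀ (by exact_mod_cast hD))
      _ = 4 * (D : ℝ≥0∞) ^ 5 * W * μ B := by
          rw [ENNReal.tsum_mul_left, ENNReal.tsum_geometric, ENNReal.one_sub_inv_two, inv_inv]
          ring
  have havg : ⨍⁻ a in B, edist (f a) (f b) ∂μ ≤ 4 * (D : ℝ≥0∞) ^ 5 * W :=
    setLAverage_le_of_lintegral_le hint
  have hmean : edist (f b) (⨍ z in B, f z ∂μ) ≤ 4 * (D : ℝ≥0∞) ^ 5 * W := by
    rw [edist_comm]
    exact (edist_setAverage_le hB0 hB1 (h.integrableOn_ball hf.continuous x r) _).trans havg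
  refine setLAverage_le_of_lintegral_le ?_
  calc ∫⁻ y in B, edist (f y) (⨍ z in B, f z ∂μ) ∂μ
      ≤ ∫⁻ y in B, (edist (f y) (f b) + 4 * (D : ℝ≥0∞) ^ 5 * W) ∂μ :=
        lintegral_mono fun y => (edist_triangle _ (f b) _).trans (by gcongr)
    _ ≤ 4 * (D : ℝ≥0∞) ^ 5 * W * μ B + 4 * (D : ℝ≥0∞) ^ 5 * W * μ B := by
        rw [lintegral_add_right _ measurable_const, setLIntegral_const]
        gcongr
    _ = 8 * (D : ℝ≥0∞) ^ 5 * W * μ B := by ring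
    _ = ENNReal.ofReal (128 * C * D ^ 5 * r * s) * μ B := by
        rw [hW, ← ENNReal.ofReal_coe_nnreal, ← ENNReal.ofReal_pow (by positivity),
          ← ENNReal.ofReal_ofNat, ← ENNReal.ofReal_mul (by positivity),
          ← ENNReal.ofReal_mul (by positivity)]
        ring_nf

theorem IsFragmentConnected.poincareInequality (h : IsDoublingMM μ D) (hD : 1 ≤ D) {C ε : ℝ}
    (hconn : IsFragmentConnected μ C ε) (hC : 1 < C) (hε : ε < 1) {q : ℕ} (hq2 : 2 ≤ q)
    (hq : 2 * (D : ℝ≥0∞) ^ 5 < ENNReal.ofReal ε * 2 ^ q) {m : ℕ} (hm : 4 * C + 1 ≤ 2 ^ m) :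
    PoincareInequality μ q (4 * C + 1) (128 * C * D ^ 5 * D ^ m) := by
  rintro n f ⟨L, hf⟩ x r hr
  simp only [ENNReal.rpow_natCast]
  set I := ⨍⁻ y in Metric.ball x ((4 * C + 1) * r), lowerLip f y ^ q ∂μ with hI
  have hD0 : 0 < (D : ℝ) := one_pos.trans_le hD
  have hq0 : (0 : ℝ) < q := by
    have : 0 < q := by omega
    exact_mod_cast this
  rcases eq_or_ne I ∞ with htop | hIfin
  · rw [htop, ENNReal.top_rpow_of_pos (by positivity),
      ENNReal.mul_top (ENNReal.ofReal_pos.2 (by positivity)).ne']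
    exact le_top
  have hR : 0 < (4 * C + 1) * r := by positivity
  set J : ℝ≥0∞ := (D : ℝ≥0∞) ^ m * I ^ (1 / q : ℝ) with hJ
  have hJfin : J ≠ ∞ := ENNReal.mul_ne_top (ENNReal.pow_ne_top ENNReal.coe_ne_top)
    (ENNReal.rpow_ne_top_of_nonneg (by positivity) hIfin)
  have hJq : (D : ℝ≥0∞) ^ m * I ≤ J ^ q := by
    have h1 : (I ^ (1 / q : ℝ)) ^ q = I := by
      rw [← ENNReal.rpow_natCast, ← ENNReal.rpow_mul, one_div_mul_cancel hq0.ne', ENNReal.rpow_one]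
    rw [hJ, mul_pow, h1]
    exact mul_le_mul' (le_self_pow₀ (one_le_pow₀ (by exact_mod_cast hD)) (by omega)) le_rfl
  have hs : ∀ s : ℝ, J.toReal < s →
      ⨍⁻ y in Metric.ball x r, edist (f y) (⨍ z in Metric.ball x r, f z ∂μ) ∂μ ≤
        ENNReal.ofReal (128 * C * D ^ 5 * r * s) := by
    intro s hs
    refine hconn.oscillation_le h hD hC hε hq2 hq hf hr (ENNReal.toReal_nonneg.trans_lt hs) ?_
    calc ∫⁻ y in Metric.ball x ((4 * C + 1) * r), lowerLip f y ^ q ∂μ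
        = μ (Metric.ball x ((4 * C + 1) * r)) * I :=
          (measure_mul_setLAverage _ (h.measure_ball_lt_top _ _ hR).ne).symm
      _ ≤ (D : ℝ≥0∞) ^ m * μ (Metric.ball x r) * I := by
          gcongr
          refine h.measure_ball_le m hr ?_
          rw [dist_self, add_zero]
          gcongr
      _ = (D : ℝ≥0∞) ^ m * I * μ (Metric.ball x r) := by ring
      _ ≤ ENNReal.ofReal s ^ q * μ (Metric.ball x r) := by
          gcongr
          refine hJq.trans ?_
          gcongr
          exact (ENNReal.le_ofReal_iff_toReal_le hJfin (ENNReal.toReal_nonneg.trans hs.le)).2 hs.le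
  have hlim : Tendsto (fun s : ℝ => ENNReal.ofReal (128 * C * D ^ 5 * r * s)) (𝓝[>] J.toReal)
      (𝓝 (ENNReal.ofReal (128 * C * D ^ 5 * r * J.toReal))) :=
    ((ENNReal.continuous_ofReal.comp (continuous_const_mul _)).tendsto _).mono_left nhdsWithin_le_nhds
  refine (ge_of_tendsto hlim (by filter_upwards [self_mem_nhdsWithin] with s using hs s)).trans_eq ?_
  rw [ENNReal.ofReal_mul (by positivity), ENNReal.ofReal_toReal hJfin, hJ, ← mul_assoc,
    ← ENNReal.ofReal_coe_nnreal, ← ENNReal.ofReal_pow (by positivity),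
    ← ENNReal.ofReal_mul (by positivity)]
  ring_nf

end

theorem theorem1p6 (D : ℝ≥0) (Φ Ψ : ℝ≥0 → ℝ≥0) (C : ℝ) (hΦ : IsGauge Φ) (hΨ : IsGauge Ψ)
    (hC : 1 ≤ C) :
    ∃ C₁ δ ε q lam C₂ : ℝ,
      1 < C₁ ∧ 0 < δ ∧ δ < 1 ∧ 0 < ε ∧ ε < 1 ∧ 1 < q ∧ 0 < lam ∧ 0 < C₂ ∧
      ∀ (X : Type*) [MetricSpace X] [ProperSpace X] [MeasurableSpace X] [BorelSpace X]
        (μ : Measure X),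
        IsDoublingMM μ D → NonhomogeneousPoincare μ Φ Ψ C →
          IsConnectedMM μ C₁ δ ε ∧ PoincareInequality μ q lam C₂ := by
  have hD : 1 ≤ max D 1 := le_max_right _ _
  obtain ⟨C₁, ε, hC₁, hε0, hε1, hconn⟩ := exists_isFragmentConnected (max D 1) Φ Ψ C hD hΦ hΨ hC
  have hD0 : 0 < max D 1 := one_pos.trans_le hD
  obtain ⟨q, hq⟩ : ∃ q : ℕ, 2 * ((max D 1 : ℝ≥0) : ℝ) ^ 5 / ε < 2 ^ q :=
    pow_unbounded_of_one_lt _ one_lt_two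
  obtain ⟨m, hm⟩ : ∃ m : ℕ, 4 * C₁ + 1 < 2 ^ m := pow_unbounded_of_one_lt _ one_lt_two
  have hq' : 2 * ((max D 1 : ℝ≥0) : ℝ≥0∞) ^ 5 < ENNReal.ofReal ε * 2 ^ (q + 2) := by
    rw [← ENNReal.ofReal_coe_nnreal, ← ENNReal.ofReal_pow NNReal.zero_le_coe,
      ← ENNReal.ofReal_ofNat, ← ENNReal.ofReal_pow zero_le_two,
      ← ENNReal.ofReal_mul zero_le_two, ← ENNReal.ofReal_mul hε0.le]
    refine (ENNReal.ofReal_lt_ofReal_iff (by positivity)).2 ?_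
    rw [div_lt_iff₀' hε0] at hq
    refine hq.trans_le ?_
    gcongr
    · norm_num
    · omega
  refine ⟨C₁, 1 / 4, ε, ((q + 2 : ℕ) : ℝ), 4 * C₁ + 1,
    128 * C₁ * (max D 1 : ℝ≥0) ^ 5 * (max D 1 : ℝ≥0) ^ m, hC₁, by norm_num, by norm_num, hε0, hε1,
    by exact_mod_cast (by omega : 1 < q + 2), by positivity, by positivity, ?_⟩
  intro X _ _ _ _ μ h hP
  have h' : IsDoublingMM μ (max D 1) := h.mono (le_max_left _ _)
  have hX := hconn X μ h' hP
  exact ⟨hX.isConnectedMM, hX.poincareInequality h' hD hC₁ hε1 (by omega) hq' hm.le⟩
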